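/- Let $n\ge 0$ be an integer, let $W$ be a real vector space of dimension $n+1$, let $\mathbb{P}_n=(W\setminus\{0\})/\mathbb{R}^{\times}$ be its projective space with its usual smooth structure (given by the affine charts below), let $A\in\mathbb{P}_n$ be a fixed point, and put $V=T_A\mathbb{P}_n$. Let $G$ be the stabilizer of $A$ in the group of projective transformations of $\mathbb{P}_n$ (those induced by invertible linear operators of $W$), let $\beta\colon G\to GL(V)$, $\beta(g)=d_Ag$, and let $H=\ker\beta$, $\bar G=G/H$. An adapted frame is a tuple $\mathcal R=(A_0,A_1,\dots,A_n,E)$ of $n+2$ points of $\mathbb{P}_n$ with $A_0=A$, any $n+1$ of which are in general position. The set $F(\mathbb{P}_n)$ of adapted frames is a smooth manifold, as an open subset of $(\mathbb{P}_n)^{n+1}$ via $(A_1,\dots,A_n,E)$. The group $G$ acts on it pointwise. Let $\Phi(\mathbb{P}_n)$ be the set of $H$-orbits in $F(\mathbb{P}_n)$ with the quotient topology, and let $p\colon\mathcal R\mapsto[\mathcal R]$ be the canonical projection. The group $\bar G$ acts on $\Phi(\mathbb{P}_n)$ by $gH\cdot[\mathcal R]=[g\cdot\mathcal R]$. A basis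 $(\vec A_0,\dots,\vec A_n)$ of $W$ generates $\mathcal R$ if $A_i=[\vec A_i]$ for all $i$ and $E=[\vec A_0+\dots+\vec A_n]$; such a basis exists, and the affine chart $\varphi_{\mathcal R}$ is the map $[x^0\vec A_0+\dots+x^n\vec A_n]\mapsto(x^1/x^0,\dots,x^n/x^0)$ on $\{x^0\neq0\}\ni A$. Let $\alpha(\mathcal R)=(\partial/\partial X^1|_A,\dots,\partial/\partial X^n|_A)$ be the natural basis of $V$ induced by $\varphi_{\mathcal R}$. Let $F(V)$ be the set of linear bases of $V$, an open subset of $V^n$, on which $GL(V)$ acts by $\psi\cdot(e_i)=(\psi(e_i))$. Theorem 4.1. The basis $\alpha(\mathcal R)$ does not depend on the choice of the basis of $W$ generating $\mathcal R$. The homomorphism $\beta$ induces a group isomorphism $\bar\beta\colon\bar G\to GL(V)$, $gH\mapsto d_Ag$; let $\bar G$ carry the Lie group structure of $GL(V)$ through it. The map $$\bar\alpha\colon\Phi(\mathbb{P}_n)\to F(V),\qquad[\mathcal R]\mapsto\alpha(\mathcal R),$$ is well defined and is an isomorphism of $\bar G$-spaces. That is: 1. $\bar\alpha(\bar g\cdot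 x)=\bar\beta(\bar g)\cdot\bar\alpha(x)$ for all $\bar g\in\bar G$ and $x\in\Phi(\mathbb{P}_n)$. 2. $\Phi(\mathbb{P}_n)$ has a smooth manifold structure for which $p$ is a smooth submersion, and for every such structure $\bar\alpha$ is a diffeomorphism. 3. $\bar G$ acts smoothly on $F(V)$ and, for every smooth structure as in 2, on $\Phi(\mathbb{P}_n)$. -/

import Mathlib

open scoped LinearAlgebra.Projectivization Manifold ContDiff
open Module

namespace ProjFrame

noncomputable section

variable {n : ℕ} {W : Type*} [AddCommGroup W] [Module ℝ W]

/-! ### Projective space as a smooth manifold -/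

/-- The quotient topology on the projective space of a finite-dimensional real vector space `W`,
where `W` carries its canonical topology. -/
instance : TopologicalSpace (ℙ ℝ W) :=
  .coinduced (Projectivization.mk' ℝ) (.induced Subtype.val (moduleTopology ℝ W))

/-- The representative of the point with affine coordinates `X` w.r.t. the basis `b`. -/
def affineVec (b : Basis (Fin (n + 1)) ℝ W) (X : EuclideanSpace ℝ (Fin n)) : W :=
  b 0 + ∑ i, X i • b i.succ

theorem repr_affineVec_zero (b : Basis (Fin (n + 1)) ℝ W) (X : EuclideanSpace ℝ (Fin n)) :
    b.repr (affineVec b X) 0 = 1 := by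
  simp [affineVec]

theorem repr_affineVec_succ (b : Basis (Fin (n + 1)) ℝ W) (X : EuclideanSpace ℝ (Fin n))
    (i : Fin n) : b.repr (affineVec b X) i.succ = X i := by
  simp [affineVec, Finsupp.single_apply, Fin.succ_ne_zero]

theorem affineVec_ne_zero (b : Basis (Fin (n + 1)) ℝ W) (X : EuclideanSpace ℝ (Fin n)) :
    affineVec b X ≠ 0 := by
  intro h
  have := repr_affineVec_zero b X
  simp [h] at this

/-- The affine coordinates `X ^ i = x ^ i / x ^ 0` of a point. -/
def affineCoord (b : Basis (Fin (n + 1)) ℝ W) (M : ℙ ℝ W) : EuclideanSpace ℝ (Fin n) :=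
  WithLp.toLp 2 fun i => b.repr M.rep i.succ / b.repr M.rep 0

theorem repr_rep_ne_zero_iff (b : Basis (Fin (n + 1)) ℝ W) (v : W) (hv : v ≠ 0) :
    b.repr (Projectivization.mk ℝ v hv).rep 0 ≠ 0 ↔ b.repr v 0 ≠ 0 := by
  obtain ⟨a, ha⟩ := Projectivization.exists_smul_eq_mk_rep ℝ v hv
  rw [← ha]
  simp [Units.smul_def]

theorem affineCoord_mk (b : Basis (Fin (n + 1)) ℝ W) (v : W) (hv : v ≠ 0) :
    affineCoord b (.mk ℝ v hv) = WithLp.toLp 2 fun i => b.repr v i.succ / b.repr v 0 := by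
  obtain ⟨a, ha⟩ := Projectivization.exists_smul_eq_mk_rep ℝ v hv
  simp only [affineCoord, ← ha]
  congr 1
  ext i
  simp [Units.smul_def, mul_div_mul_left]

theorem repr_ne_iff (b : Basis (Fin (n + 1)) ℝ W) (v : {v : W // v ≠ 0}) :
    b.repr (Projectivization.mk' ℝ v).rep 0 ≠ 0 ↔ b.repr v.1 0 ≠ 0 :=
  repr_rep_ne_zero_iff b v.1 v.2

theorem continuous_coord (b : Basis (Fin (n + 1)) ℝ W) (i : Fin (n + 1)) :
    @Continuous W ℝ (moduleTopology ℝ W) _ (fun v => b.repr v i) := by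
  let _ := moduleTopology ℝ W
  have : IsModuleTopology ℝ W := ⟨rfl⟩
  exact IsModuleTopology.continuous_of_linearMap (b.coord i)

theorem isOpen_source (b : Basis (Fin (n + 1)) ℝ W) :
    IsOpen {M : ℙ ℝ W | b.repr M.rep 0 ≠ 0} := by
  let _ := moduleTopology ℝ W
  rw [isOpen_coinduced]
  simp only [Set.preimage_ofPred_eq, repr_ne_iff]
  exact isOpen_ne.preimage ((continuous_coord b 0).comp continuous_subtype_val)

/-- The affine chart on `{x ^ 0 ≠ 0}` determined by a basis of the associated vector space. -/
def affineChart (b : Basis (Fin (n + 1)) ℝ W) :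
    OpenPartialHomeomorph (ℙ ℝ W) (EuclideanSpace ℝ (Fin n)) where
  toFun := affineCoord b
  invFun X := .mk ℝ (affineVec b X) (affineVec_ne_zero b X)
  source := {M | b.repr M.rep 0 ≠ 0}
  target := Set.univ
  map_source' _ _ := trivial
  map_target' X _ := by
    rw [Set.mem_ofPred_eq, repr_rep_ne_zero_iff, repr_affineVec_zero]
    exact one_ne_zero
  left_inv' M hM := by
    rw [Set.mem_ofPred_eq] at hM
    conv_rhs => rw [← M.mk_rep]
    rw [Projectivization.mk_eq_mk_iff']
    refine ⟨(b.repr M.rep 0)⁻¹, b.ext_elem fun i => ?_⟩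
    refine Fin.cases ?_ (fun i => ?_) i
    · simp [repr_affineVec_zero, hM]
    · simp [repr_affineVec_succ, affineCoord, div_eq_inv_mul]
  right_inv' X _ := by
    rw [affineCoord_mk]
    ext i
    simp [repr_affineVec_zero, repr_affineVec_succ]
  open_source := isOpen_source b
  open_target := isOpen_univ
  continuousOn_toFun := by
    let _ := moduleTopology ℝ W
    have hq : Topology.IsQuotientMap (Projectivization.mk' ℝ : {v : W // v ≠ 0} → ℙ ℝ W) :=
      ⟨⟨rfl⟩, Quotient.mk''_surjective⟩
    rw [hq.continuousOn_isOpen_iff (isOpen_source b)]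
    refine (PiLp.continuous_toLp 2 _).comp_continuousOn (f := fun (v : {v : W // v ≠ 0}) (i : Fin n) =>
      b.repr v.1 i.succ / b.repr v.1 0) ?_ |>.congr fun v _ => affineCoord_mk b v.1 v.2
    refine continuousOn_pi.2 fun i => ContinuousOn.div ?_ ?_ ?_
    · exact ((continuous_coord b i.succ).comp continuous_subtype_val).continuousOn
    · exact ((continuous_coord b 0).comp continuous_subtype_val).continuousOn
    · intro v hv
      exact (repr_ne_iff b v).1 hv
  continuousOn_invFun := by
    let _ := moduleTopology ℝ W
    have := ModuleTopology.continuousAdd ℝ W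
    have := ModuleTopology.continuousSMul ℝ W
    refine Continuous.continuousOn ?_
    have h : Continuous fun X : EuclideanSpace ℝ (Fin n) =>
        (⟨affineVec b X, affineVec_ne_zero b X⟩ : {v : W // v ≠ 0}) := by
      refine Continuous.subtype_mk ?_ _
      unfold affineVec
      fun_prop
    exact continuous_coinduced_rng.comp h


theorem mem_affineChart_source_mk (b : Basis (Fin (n + 1)) ℝ W) (v : W) (hv : v ≠ 0) :
    Projectivization.mk ℝ v hv ∈ (affineChart b).source ↔ b.repr v 0 ≠ 0 :=
  repr_rep_ne_zero_iff b v hv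

theorem exists_basis (n : ℕ) [hd : Fact (finrank ℝ W = n + 1)] (M : ℙ ℝ W) :
    ∃ b : Basis (Fin (n + 1)) ℝ W, M ∈ (affineChart b).source := by
  have : FiniteDimensional ℝ W := .of_fact_finrank_eq_succ n
  let b := finBasisOfFinrankEq ℝ W hd.out
  obtain ⟨i, hi⟩ : ∃ i, b.repr M.rep i ≠ 0 := by
    by_contra! h
    exact M.rep_nonzero (b.ext_elem (by simpa using h))
  refine ⟨b.reindex (Equiv.swap 0 i), ?_⟩
  change (b.reindex (Equiv.swap 0 i)).repr M.rep 0 ≠ 0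
  simpa using hi

/-- The smooth atlas of the projective space, given by all affine charts. -/
instance [Fact (finrank ℝ W = n + 1)] :
    ChartedSpace (EuclideanSpace ℝ (Fin n)) (ℙ ℝ W) where
  atlas := Set.range affineChart
  chartAt M := affineChart (exists_basis n M).choose
  mem_chart_source M := (exists_basis n M).choose_spec
  chart_mem_atlas _ := Set.mem_range_self _

theorem contDiff_affineVec (b : Basis (Fin (n + 1)) ℝ W) (c : Basis (Fin (n + 1)) ℝ W)
    (k : WithTop ℕ∞) (i : Fin (n + 1)) :
    ContDiff ℝ k fun X : EuclideanSpace ℝ (Fin n) => c.repr (affineVec b X) i := by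
  simp only [affineVec, map_add, map_sum, map_smul, Finsupp.add_apply, Finsupp.smul_apply,
    Finsupp.finsetSum_apply]
  fun_prop

theorem contDiffOn_transition (b c : Basis (Fin (n + 1)) ℝ W) (k : WithTop ℕ∞) :
    ContDiffOn ℝ k (affineChart c ∘ (affineChart b).symm)
      ((affineChart b).symm ⁻¹' (affineChart c).source) := by
  have h2 : ContDiffOn ℝ k (fun X : EuclideanSpace ℝ (Fin n) => WithLp.toLp 2 fun i : Fin n =>
      c.repr (affineVec b X) i.succ / c.repr (affineVec b X) 0)
      {X | c.repr (affineVec b X) 0 ≠ 0} := by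
    refine contDiffOn_euclidean.2 fun i => ?_
    exact ((contDiff_affineVec b c k i.succ).contDiffOn).div
      (contDiff_affineVec b c k 0).contDiffOn fun X hX => hX
  refine (h2.mono fun X hX => ?_).congr fun X _ => affineCoord_mk c _ (affineVec_ne_zero b X)
  exact (mem_affineChart_source_mk c _ (affineVec_ne_zero b X)).1 hX

instance [Fact (finrank ℝ W = n + 1)] (k : WithTop ℕ∞) :
    IsManifold (𝓡 n) k (ℙ ℝ W) := by
  refine isManifold_of_contDiffOn _ _ _ ?_
  rintro _ _ ⟨b, rfl⟩ ⟨c, rfl⟩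
  exact (contDiffOn_transition b c k).mono fun X hX => hX.1.2

/-! ### Projective frames -/

/-- A projective frame `A₀, …, Aₙ, E`: any `n + 1` of the `n + 2` points are in general
position. -/
def IsProjFrame (R : Fin (n + 2) → ℙ ℝ W) : Prop :=
  ∀ k : Fin (n + 2), Projectivization.Independent fun i : Fin (n + 1) => R (k.succAbove i)

/-- The basis `b` of the associated vector space generates `R = (A₀, …, Aₙ, E)`. -/
def Generates (b : Basis (Fin (n + 1)) ℝ W) (R : Fin (n + 2) → ℙ ℝ W) : Prop :=
  (∀ i : Fin (n + 1), Projectivization.mk ℝ (b i) (b.ne_zero i) = R i.castSucc) ∧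
    ∃ h : ∑ i, b i ≠ 0, Projectivization.mk ℝ (∑ i, b i) h = R (Fin.last (n + 1))

theorem independent_mk_iff {ι : Type*} (v : ι → {v : W // v ≠ 0}) :
    Projectivization.Independent (fun i => Projectivization.mk' ℝ (v i)) ↔
      LinearIndependent ℝ fun i => (v i : W) := by
  refine ⟨fun h => ?_, fun h => .mk _ (fun i => (v i).2) h⟩
  rw [Projectivization.independent_iff] at h
  choose a ha using fun i => Projectivization.exists_smul_eq_mk_rep ℝ (v i).1 (v i).2
  have h2 := h.units_smul fun i => (a i)⁻¹
  convert! h2 using 1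
  ext i
  simp [← ha, Projectivization.mk'_eq_mk]

theorem IsProjFrame.exists_generates [hd : Fact (finrank ℝ W = n + 1)]
    {R : Fin (n + 2) → ℙ ℝ W} (hR : IsProjFrame R) :
    ∃ b : Basis (Fin (n + 1)) ℝ W, Generates b R := by
  have hli := fun k => Projectivization.independent_iff.1 (hR k)
  have h0 := hli (Fin.last _)
  simp only [Fin.succAbove_last] at h0
  let b₀ : Basis (Fin (n + 1)) ℝ W :=
    basisOfLinearIndependentOfCardEqFinrank h0 (by simp [hd.out])
  have hb₀ : ∀ i, b₀ i = (R i.castSucc).rep := fun i => by simp [b₀]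
  let c := b₀.repr (R (Fin.last _)).rep
  have hc : ∀ i, c i ≠ 0 := by
    intro i hi
    let d : Fin (n + 2) → ℝ := Fin.snoc (α := fun _ => ℝ) c (-1)
    have hsum : ∑ k, d k • (R k).rep = 0 := by
      rw [Fin.sum_univ_castSucc]
      have := b₀.sum_repr (R (Fin.last _)).rep
      simp only [hb₀] at this
      simp [d, c, this]
    rw [Fin.sum_univ_succAbove _ i.castSucc] at hsum
    have hdi : d i.castSucc = 0 := by simp [d, hi]
    rw [hdi, zero_smul, zero_add] at hsum
    have := Fintype.linearIndependent_iff.1 (hli i.castSucc) _ hsum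
    obtain ⟨j, hj⟩ := Fin.exists_succAbove_eq (x := Fin.last (n + 1)) (y := i.castSucc)
      (Fin.castSucc_lt_last i).ne'
    have := this j
    rw [hj] at this
    simp [d] at this
  refine ⟨b₀.unitsSMul fun i => Units.mk0 (c i) (hc i), fun i => ?_, ?_⟩
  · conv_rhs => rw [← Projectivization.mk_rep (R i.castSucc)]
    rw [Projectivization.mk_eq_mk_iff']
    exact ⟨c i, by simp [Module.Basis.unitsSMul_apply, hb₀, Units.smul_def]⟩
  · have hs : ∑ i, (b₀.unitsSMul fun i => Units.mk0 (c i) (hc i)) i = (R (Fin.last _)).rep := by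
      conv_rhs => rw [← b₀.sum_repr (R (Fin.last _)).rep]
      simp [c, Module.Basis.unitsSMul_apply, Units.smul_def]
    refine ⟨by rw [hs]; exact Projectivization.rep_nonzero _, ?_⟩
    simp only [hs, Projectivization.mk_rep]

theorem Generates.mem_source {A : ℙ ℝ W} {b : Basis (Fin (n + 1)) ℝ W} {R : Fin (n + 1) → ℙ ℝ W}
    (h : Generates b (Fin.cons A R : Fin (n + 2) → ℙ ℝ W)) : A ∈ (affineChart b).source := by
  have h0 : _ = A := h.1 0
  rw [← h0, mem_affineChart_source_mk]
  simp

theorem isOpenQuotientMap_mk' :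
    @IsOpenQuotientMap _ _ (.induced Subtype.val (moduleTopology ℝ W)) _
      (Projectivization.mk' ℝ : {v : W // v ≠ 0} → ℙ ℝ W) := by
  let _ := moduleTopology ℝ W
  have := ModuleTopology.continuousSMul ℝ W
  refine ⟨Quotient.mk''_surjective, continuous_coinduced_rng, fun U hU => ?_⟩
  rw [isOpen_coinduced]
  have h : Projectivization.mk' ℝ ⁻¹' (Projectivization.mk' ℝ '' U) =
      ⋃ a : ℝˣ, (fun v : {v : W // v ≠ 0} =>
        (⟨a • v.1, (smul_ne_zero_iff_ne a).2 v.2⟩ : {v : W // v ≠ 0})) ⁻¹' U := by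
    ext v
    simp only [Set.mem_preimage, Set.mem_image, Set.mem_iUnion, Projectivization.mk'_eq_mk,
      Projectivization.mk_eq_mk_iff]
    constructor
    · rintro ⟨w, hw, a, ha⟩
      refine ⟨a, ?_⟩
      convert! hw
    · rintro ⟨a, ha⟩
      exact ⟨_, ha, a, rfl⟩
  rw [h]
  refine isOpen_iUnion fun a => hU.preimage (Continuous.subtype_mk ?_ _)
  exact (continuous_const_smul (a : ℝ)).comp continuous_subtype_val

theorem isOpen_independent [hd : Fact (finrank ℝ W = n + 1)] {ι : Type*} [Finite ι] :
    IsOpen {R : ι → ℙ ℝ W | Projectivization.Independent R} := by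
  let _ := moduleTopology ℝ W
  have : FiniteDimensional ℝ W := .of_fact_finrank_eq_succ n
  have hq := IsOpenQuotientMap.piMap fun _ : ι => isOpenQuotientMap_mk' (W := W)
  rw [← hq.isQuotientMap.isOpen_preimage]
  let b := finBasisOfFinrankEq ℝ W hd.out
  have hs : Pi.map (fun _ : ι => (Projectivization.mk' ℝ : {v : W // v ≠ 0} → ℙ ℝ W)) ⁻¹'
      {R | Projectivization.Independent R} =
      (fun (v : ι → {v : W // v ≠ 0}) i j => b.repr (v i) j) ⁻¹'
        {f : ι → Fin (n + 1) → ℝ | LinearIndependent ℝ f} := by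
    ext v
    refine (independent_mk_iff v).trans ?_
    exact (LinearMap.linearIndependent_iff (b.equivFun : W →ₗ[ℝ] Fin (n + 1) → ℝ)
      (LinearEquiv.ker _)).symm
  rw [hs]
  refine isOpen_setOfPred_linearIndependent.preimage ?_
  exact continuous_pi fun i => continuous_pi fun j =>
    (continuous_coord b j).comp (continuous_subtype_val.comp (continuous_apply i))

/-- The space of adapted frames `(A, A₁, …, Aₙ, E)`, as the open subset of `(ℙ W) ^ (n + 1)`
formed by the tuples `(A₁, …, Aₙ, E)`. -/
def AdaptedFrame (n : ℕ) [Fact (finrank ℝ W = n + 1)] (A : ℙ ℝ W) :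
    TopologicalSpace.Opens (Fin (n + 1) → ℙ ℝ W) where
  carrier := {R | IsProjFrame (Fin.cons A R : Fin (n + 2) → ℙ ℝ W)}
  is_open' := by
    simp only [IsProjFrame, Set.ofPred_forall]
    refine isOpen_iInter_of_finite fun k => (isOpen_independent (n := n)).preimage ?_
    refine continuous_pi fun i => ?_
    generalize k.succAbove i = j
    refine Fin.cases ?_ (fun j => ?_) j
    · simpa using continuous_const
    · simpa using continuous_apply j

/-- The model with corners of the manifold `(ℙ W) ^ (n + 1)`. -/
abbrev frameModel (n : ℕ) := ModelWithCorners.pi fun _ : Fin (n + 1) => 𝓡 n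

instance [Fact (finrank ℝ W = n + 1)] (k : WithTop ℕ∞) :
    IsManifold (frameModel n) k (Fin (n + 1) → ℙ ℝ W) := by
  refine isManifold_of_contDiffOn _ _ _ ?_
  rintro _ _ ⟨e, he, rfl⟩ ⟨e', he', rfl⟩
  refine contDiffOn_pi.2 fun i => ?_
  obtain ⟨b, hb⟩ := he i trivial
  obtain ⟨c, hc⟩ := he' i trivial
  have h : ContDiffOn ℝ k (e' i ∘ (e i).symm) ((e i).symm ⁻¹' (e' i).source) := by
    rw [← hb, ← hc]
    exact contDiffOn_transition b c k
  refine h.comp (g := e' i ∘ (e i).symm)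
    (f := fun x : Fin (n + 1) → EuclideanSpace ℝ (Fin n) => x i)
    (contDiff_apply ℝ (EuclideanSpace ℝ (Fin n)) i).contDiffOn fun x hx => ?_
  exact hx.1.2 i trivial

/-! ### The tangent space at the centre and its linear frames -/

/-- The tangent space `V = T_A ℙ W`. Mathlib realizes it on the vector space `ℝ ^ n`, whose norm only
serves to give `V` its canonical topology and smooth structure. -/
def Tan (n : ℕ) [Fact (finrank ℝ W = n + 1)] (A : ℙ ℝ W) : Type := TangentSpace (𝓡 n) A

section
variable [Fact (finrank ℝ W = n + 1)] (A : ℙ ℝ W)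

instance : NormedAddCommGroup (Tan n A) :=
  inferInstanceAs (NormedAddCommGroup (EuclideanSpace ℝ (Fin n)))
instance : NormedSpace ℝ (Tan n A) :=
  inferInstanceAs (NormedSpace ℝ (EuclideanSpace ℝ (Fin n)))
instance : FiniteDimensional ℝ (Tan n A) :=
  inferInstanceAs (FiniteDimensional ℝ (EuclideanSpace ℝ (Fin n)))
instance : CompleteSpace (Tan n A) :=
  inferInstanceAs (CompleteSpace (EuclideanSpace ℝ (Fin n)))

end

/-- The general linear group of `V = T_A ℙ W`. -/
abbrev GLTan (n : ℕ) [Fact (finrank ℝ W = n + 1)] (A : ℙ ℝ W) : Type :=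
  (Tan n A →L[ℝ] Tan n A)ˣ

/-- The space of linear frames (bases) of `V = T_A ℙ W`, as an open subset of `V ^ n`. -/
def LinearFrame (n : ℕ) [Fact (finrank ℝ W = n + 1)] (A : ℙ ℝ W) :
    TopologicalSpace.Opens (Fin n → Tan n A) where
  carrier := {ε | LinearIndependent ℝ ε ∧ Submodule.span ℝ (Set.range ε) = ⊤}
  is_open' := by
    have h : {ε : Fin n → Tan n A | LinearIndependent ℝ ε ∧ Submodule.span ℝ (Set.range ε) = ⊤} =
        {ε | LinearIndependent ℝ ε} := by
      ext ε
      refine ⟨fun h => h.1, fun h => ⟨h, h.span_eq_top_of_card_eq_finrank' ?_⟩⟩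
      exact (finrank_euclideanSpace.symm : _ = finrank ℝ (EuclideanSpace ℝ (Fin n)))
    rw [h]
    exact isOpen_setOfPred_linearIndependent


/-! ### Projective transformations and the linearizing homomorphism -/

/-- The group `GP(n)` of projective transformations: the transformations of `ℙ W` which are
induced by invertible linear operators of `W`. -/
def projGroup (W : Type*) [AddCommGroup W] [Module ℝ W] : Subgroup (Equiv.Perm (ℙ ℝ W)) :=
  (MulAction.toPermHom (W ≃ₗ[ℝ] W) (ℙ ℝ W)).range

/-- The group `G`: the stabilizer of the centre `A` in the projective group. -/
def centreStab (A : ℙ ℝ W) : Subgroup (projGroup W) := MulAction.stabilizer (projGroup W) A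

theorem projGroup_apply_eq (f : projGroup W) : ∃ u : W ≃ₗ[ℝ] W, ∀ M : ℙ ℝ W, f • M = u • M := by
  obtain ⟨f, u, rfl⟩ := f
  exact ⟨u, fun _ => rfl⟩

theorem smul_centre {A : ℙ ℝ W} (g : centreStab A) : g • A = A := g.2

theorem affineChart_map_smul (b : Basis (Fin (n + 1)) ℝ W) (u : W ≃ₗ[ℝ] W) (M : ℙ ℝ W) :
    affineCoord (b.map u) (u • M) = affineCoord b M ∧
      (u • M ∈ (affineChart (b.map u)).source ↔ M ∈ (affineChart b).source) := by
  induction M with | h v hv =>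
  rw [Projectivization.smul_mk, affineCoord_mk, affineCoord_mk, mem_affineChart_source_mk,
    mem_affineChart_source_mk]
  simp [LinearEquiv.smul_def]

theorem contMDiff_projGroup [Fact (finrank ℝ W = n + 1)] (k : WithTop ℕ∞) (f : projGroup W) :
    ContMDiff (𝓡 n) (𝓡 n) k fun M : ℙ ℝ W => f • M := by
  obtain ⟨u, hu⟩ := projGroup_apply_eq f
  intro M
  obtain ⟨b, hb⟩ := exists_basis n M
  have hmem : ∀ b : Basis (Fin (n + 1)) ℝ W,
      affineChart b ∈ IsManifold.maximalAtlas (𝓡 n) k (ℙ ℝ W) := fun b =>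
    IsManifold.subset_maximalAtlas (Set.mem_range_self b)
  have h1 : ContMDiffOn (𝓡 n) (𝓡 n) k ((affineChart (b.map u)).symm ∘ affineChart b)
      (affineChart b).source :=
    (contMDiffOn_symm_of_mem_maximalAtlas (hmem (b.map u))).comp
      (contMDiffOn_of_mem_maximalAtlas (hmem b)) fun _ _ => Set.mem_univ _
  refine (h1.congr fun N hN => ?_).contMDiffAt ((affineChart b).open_source.mem_nhds hb)
  have h2 := affineChart_map_smul b u N
  rw [hu]
  refine ((affineChart (b.map u)).left_inv (h2.2.2 hN)).symm.trans ?_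
  exact congrArg (affineChart (b.map u)).symm h2.1

theorem IsProjFrame.smul {R : Fin (n + 2) → ℙ ℝ W} (hR : IsProjFrame R) (f : projGroup W) :
    IsProjFrame fun i => f • R i := by
  obtain ⟨u, hu⟩ := projGroup_apply_eq f
  intro k
  simp only [hu]
  have h := Projectivization.independent_iff.1 (hR k)
  have h2 := h.map' (u : W →ₗ[ℝ] W) (LinearEquiv.ker u)
  convert! Projectivization.Independent.mk _ (fun i => ?_) h2 using 1
  · ext1 i
    conv_lhs => rw [← Projectivization.mk_rep (R (k.succAbove i))]
    rfl
  · simp [Projectivization.rep_nonzero]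

section
variable (n) [Fact (finrank ℝ W = n + 1)] (A : ℙ ℝ W)

theorem mdifferentiableAt_smul (g : centreStab A) (M : ℙ ℝ W) :
    MDifferentiableAt (𝓡 n) (𝓡 n) (fun M : ℙ ℝ W => g • M) M :=
  (contMDiff_projGroup 1 (g : projGroup W)).mdifferentiable one_ne_zero M

/-- The differential `d_A g : T_A → T_{g A} = T_A` of a transformation `g` fixing `A`. -/
def centreDeriv (g : centreStab A) : Tan n A →L[ℝ] Tan n A :=
  (mfderiv (𝓡 n) (𝓡 n) (fun M : ℙ ℝ W => g • M) A :)

/-- The linearizing homomorphism `β : G → GL(V)`, `g ↦ d_A g`. -/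
def beta : centreStab A →* GLTan n A :=
  MonoidHom.toHomUnits
    { toFun := centreDeriv n A
      map_one' := by
        have h : (fun M : ℙ ℝ W => (1 : centreStab A) • M) = id := funext fun M => one_smul _ M
        rw [centreDeriv, h]
        exact mfderiv_id
      map_mul' := fun g h => by
        have h1 : (fun M : ℙ ℝ W => (g * h) • M) = (fun M => g • M) ∘ fun M : ℙ ℝ W => h • M :=
          funext fun M => mul_smul _ _ M
        have h2 := mfderiv_comp A (mdifferentiableAt_smul n A g (h • A))
          (mdifferentiableAt_smul n A h A)
        rw [← h1] at h2
        have h3 : ∀ B : ℙ ℝ W, B = A →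
            (mfderiv (𝓡 n) (𝓡 n) (fun M : ℙ ℝ W => g • M) B :
              EuclideanSpace ℝ (Fin n) →L[ℝ] EuclideanSpace ℝ (Fin n)) =
            mfderiv (𝓡 n) (𝓡 n) (fun M : ℙ ℝ W => g • M) A := by
          rintro _ rfl
          rfl
        refine ContinuousLinearMap.ext fun v => ?_
        exact (DFunLike.congr_fun h2 v).trans (DFunLike.congr_fun (h3 (h • A) (smul_centre h)) _) }

theorem coe_beta (g : centreStab A) : (beta n A g : Tan n A →L[ℝ] Tan n A) = centreDeriv n A g :=
  rfl

/-- The kernel `H` of the linearizing homomorphism. -/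
abbrev kernelH : Subgroup (centreStab A) := (beta n A).ker

/-! ### The actions on frames and the orbit space -/

variable {A} in
theorem isProjFrame_smul (g : centreStab A) {R : Fin (n + 1) → ℙ ℝ W}
    (hR : IsProjFrame (Fin.cons A R : Fin (n + 2) → ℙ ℝ W)) :
    IsProjFrame (Fin.cons A (g • R) : Fin (n + 2) → ℙ ℝ W) := by
  convert! hR.smul (g : projGroup W) using 1
  ext1 i
  refine Fin.cases ?_ (fun j => rfl) i
  exact (smul_centre g).symm

/-- The frame action of `G` on adapted frames: `g • (A, A₁, …, E) = (A, g A₁, …, g E)`. -/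
instance : MulAction (centreStab A) (AdaptedFrame n A) where
  smul g R := ⟨g • (R.1 : Fin (n + 1) → ℙ ℝ W), isProjFrame_smul n g R.2⟩
  one_smul _ := Subtype.ext (one_smul _ _)
  mul_smul _ _ _ := Subtype.ext (mul_smul _ _ _)

/-- The frame action of `GL(V)` on linear frames: `(ψ • ε) i = ψ (ε i)`. -/
instance : MulAction (GLTan n A) (LinearFrame n A) where
  smul ψ ε := ⟨fun i => (ψ : Tan n A →L[ℝ] Tan n A) ((ε : Fin n → Tan n A) i), by
    let e := (ContinuousLinearEquiv.unitsEquiv ℝ (Tan n A) ψ).toLinearEquiv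
    refine ⟨ε.2.1.map' (e : Tan n A →ₗ[ℝ] Tan n A) (LinearEquiv.ker e), ?_⟩
    have h : Set.range (fun i => (ψ : Tan n A →L[ℝ] Tan n A) ((ε : Fin n → Tan n A) i)) =
        (e : Tan n A →ₗ[ℝ] Tan n A) '' Set.range (ε : Fin n → Tan n A) := by
      rw [← Set.range_comp]
      rfl
    rw [h, Submodule.span_image, ε.2.2, Submodule.map_top, LinearEquiv.range]⟩
  one_smul _ := rfl
  mul_smul _ _ _ := rfl

/-- The orbit space `Φ` of the manifold of adapted frames under the action of `H`, with its
quotient topology. -/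
def OrbitSpace : Type _ := MulAction.orbitRel.Quotient (kernelH n A) (AdaptedFrame n A)

instance : TopologicalSpace (OrbitSpace n A) :=
  inferInstanceAs (TopologicalSpace
    (Quotient (MulAction.orbitRel (kernelH n A) (AdaptedFrame n A))))

variable {n A} in
/-- The canonical projection `p`, sending an adapted frame to its `H`-orbit. -/
def toOrbit (R : AdaptedFrame n A) : OrbitSpace n A :=
  Quotient.mk (MulAction.orbitRel (kernelH n A) (AdaptedFrame n A)) R

variable {n A} in
theorem toOrbit_eq_iff {R S : AdaptedFrame n A} :
    toOrbit R = toOrbit S ↔ ∃ h : kernelH n A, h • S = R :=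
  Quotient.eq (r := MulAction.orbitRel (kernelH n A) (AdaptedFrame n A))

theorem toOrbit_smul_eq {g g' : centreStab A} (hg : g⁻¹ * g' ∈ kernelH n A)
    {R S : AdaptedFrame n A} (hR : toOrbit R = toOrbit S) : toOrbit (g • R) = toOrbit (g' • S) := by
  obtain ⟨h, rfl⟩ := toOrbit_eq_iff.1 hR
  have hk : g * (h : centreStab A) * g'⁻¹ ∈ kernelH n A := by
    have h1 : (h : centreStab A) * (g⁻¹ * g')⁻¹ ∈ kernelH n A := mul_mem h.2 (inv_mem hg)
    have h2 := (inferInstance : (kernelH n A).Normal).conj_mem _ h1 g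
    simpa [mul_assoc] using h2
  refine toOrbit_eq_iff.2 ⟨⟨_, hk⟩, ?_⟩
  change (g * (h : centreStab A) * g'⁻¹) • g' • S = g • (h : centreStab A) • S
  simp [mul_smul]

/-- The quotient action of `Ḡ = G / H` on the orbit space: `gH • [R] = [g • R]`. -/
instance : MulAction (centreStab A ⧸ kernelH n A) (OrbitSpace n A) where
  smul := Quotient.map₂ (· • ·) fun g g' hg R S hR =>
    Quotient.exact (toOrbit_smul_eq n A (QuotientGroup.leftRel_apply.1 hg)
      (Quotient.sound (s := MulAction.orbitRel (kernelH n A) (AdaptedFrame n A)) hR))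
  one_smul := by
    rintro ⟨R⟩
    exact congrArg toOrbit (one_smul (centreStab A) R)
  mul_smul := by
    rintro ⟨g⟩ ⟨h⟩ ⟨R⟩
    exact congrArg toOrbit (mul_smul g h R)

theorem mk_smul_toOrbit (g : centreStab A) (R : AdaptedFrame n A) :
    (QuotientGroup.mk g : centreStab A ⧸ kernelH n A) • toOrbit R = toOrbit (g • R) :=
  rfl

/-! ### Natural bases -/

variable {n A} in
/-- The natural basis of `V = T_A ℙ W` induced by the affine chart of `b`: its members are the
coordinate vectors `∂ / ∂ X ^ i` at `A`. -/
def naturalBasis (b : Basis (Fin (n + 1)) ℝ W) (hb : A ∈ (affineChart b).source) :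
    LinearFrame n A :=
  ⟨fun i => (mfderiv (𝓡 n) (𝓡 n) (affineChart b).symm (affineChart b A)
      (EuclideanSpace.single i (1 : ℝ)) :), by
    have hd : (affineChart b).MDifferentiable (𝓡 n) (𝓡 n) :=
      mdifferentiable_of_mem_atlas (Set.mem_range_self b)
    let e : EuclideanSpace ℝ (Fin n) ≃L[ℝ] Tan n A := (hd.mfderiv hb).symm
    have h : (fun i => (mfderiv (𝓡 n) (𝓡 n) (affineChart b).symm (affineChart b A)
        (EuclideanSpace.single i (1 : ℝ)) : Tan n A)) =
        (EuclideanSpace.basisFun (Fin n) ℝ).toBasis.map e.toLinearEquiv := by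
      ext1 i
      simp
      rfl
    refine ⟨?_, ?_⟩
    · exact h ▸ Basis.linearIndependent _
    · exact h ▸ Basis.span_eq _⟩

variable {n A} in
/-- The map `α`, sending an adapted frame to the natural basis induced by its affine chart. -/
def alpha (R : AdaptedFrame n A) : LinearFrame n A :=
  naturalBasis R.2.exists_generates.choose
    (Generates.mem_source R.2.exists_generates.choose_spec)

/-! ### The smooth structure of the orbit space -/

/-- A charted space structure makes the orbit space the quotient manifold of the manifold of
adapted frames if it is smooth and the canonical projection is a smooth submersion. -/
structure IsQuotientManifold (m : ℕ) [ChartedSpace (EuclideanSpace ℝ (Fin m)) (OrbitSpace n A)] :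
    Prop where
  isManifold : IsManifold (𝓡 m) ∞ (OrbitSpace n A)
  contMDiff : ContMDiff (frameModel n) (𝓡 m) ∞ (toOrbit : AdaptedFrame n A → OrbitSpace n A)
  surjective_mfderiv : ∀ R : AdaptedFrame n A,
    Function.Surjective (mfderiv (frameModel n) (𝓡 m) (toOrbit : _ → OrbitSpace n A) R)

end

end

end ProjFrame

/-! Fix the representative `a = centreVec` of $A$ whose zeroth coordinate in the preferred basis is
1. The preferred chart then identifies $V$ with $W/\mathbb{R}a$ through `toTan`. If $b$ generates
the frame and $b_0=\mu a$, differentiating the chart along $b_0+tb_j$ gives $\partial/\partial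
X^j|_A=\mu^{-1}\,$`toTan`$(b_j)$ (`naturalBasis_apply`). With arbitrary representatives $v_j$ of
$A_1,\dots,A_n,E$, Cramer's rule finds the generating basis up to a common factor, which cancels in
this expression (`Generates.frameFormula_eq`). The resulting formula does not mention $b$, so
$\alpha$ is independent of $b$; it is rational in the coordinates, so $\alpha$ is smooth.

The group statements are formal. The chain rule gives $\alpha(gR)=\beta(g)\alpha(R)$; $G$ is
transitive on adapted frames and $GL(V)$ acts freely on bases. Hence frames with equal $\alpha$
differ by an element of $H$, and, since $\alpha$ is onto, so is $\beta$.

Smoothness of the inverse comes from explicit smooth sections `liftFrame κ` of $\alpha$, whose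
images together cover all adapted frames. They make $\bar\alpha$ a homeomorphism, through which a
quotient structure is built. For an arbitrary quotient structure, $\bar\alpha^{-1}=p\circ$`liftFrame
0` is smooth, and $p=\bar\alpha^{-1}\circ\alpha$ makes it a submersion. An injective submersion has
bijective differential, so the inverse function theorem applies without knowing the dimension
beforehand. -/

namespace ProjFrame

noncomputable section

section General
open Topology

/-! ### Finite products of manifolds -/

section Pi
variable {ι : Type*} [Fintype ι] {E : Type*} [NormedAddCommGroup E] [NormedSpace ℝ E]
  {H : Type*} [TopologicalSpace H] {I : ModelWithCorners ℝ E H}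
  {M : Type*} [TopologicalSpace M] [ChartedSpace H M]
  {E' : Type*} [NormedAddCommGroup E'] [NormedSpace ℝ E']
  {H' : Type*} [TopologicalSpace H'] {J : ModelWithCorners ℝ E' H'}
  {N : Type*} [TopologicalSpace N] [ChartedSpace H' N]

/-- The preferred charts of a product are products of charts, so continuity and the coordinate
expression both split into components. -/
theorem contMDiff_pi_iff {k : WithTop ℕ∞} {f : N → ι → M} :
    ContMDiff J (ModelWithCorners.pi fun _ : ι => I) k f ↔
      ∀ i, ContMDiff J I k fun x => f x i := by
  simp only [ContMDiff, ContMDiffAt, contMDiffWithinAt_iff, continuousWithinAt_pi]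
  rw [forall_comm]
  refine forall_congr' fun x => ?_
  rw [forall_and]
  refine and_congr Iff.rfl ?_
  exact contDiffWithinAt_pi

theorem contMDiff_eval {k : WithTop ℕ∞} (i : ι) :
    ContMDiff (ModelWithCorners.pi fun _ : ι => I) I k fun x : ι → M => x i :=
  contMDiff_pi_iff.1 contMDiff_id i

end Pi

/-! ### Cramer's rule depends smoothly on the data -/

theorem contDiff_det {E : Type*} [NormedAddCommGroup E] [NormedSpace ℝ E] {ι : Type*} [Fintype ι]
    [DecidableEq ι] {k : WithTop ℕ∞} {M : E → Matrix ι ι ℝ}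
    (hM : ∀ i j, ContDiff ℝ k fun x => M x i j) : ContDiff ℝ k fun x => (M x).det := by
  simp only [Matrix.det_apply]
  exact ContDiff.sum fun σ _ => (contDiff_prod fun i _ => hM _ _).const_smul _

/-- Cramer's numerators are polynomial in the data, so no invertibility is needed here. -/
theorem contDiff_cramer {E : Type*} [NormedAddCommGroup E] [NormedSpace ℝ E] {ι : Type*}
    [Fintype ι] [DecidableEq ι] {k : WithTop ℕ∞} {M : E → Matrix ι ι ℝ} {w : E → ι → ℝ}
    (hM : ∀ i j, ContDiff ℝ k fun x => M x i j) (hw : ∀ i, ContDiff ℝ k fun x => w x i) (i : ι) :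
    ContDiff ℝ k fun x => (M x).cramer (w x) i := by
  simp only [Matrix.cramer_apply]
  refine contDiff_det fun j l => ?_
  simp only [Matrix.updateCol_apply]
  split_ifs
  · exact hw j
  · exact hM j l

/-! ### Injective submersions -/

/-- The implicit function theorem parametrizes the fibre through $a$ by the kernel, with the
inclusion of the kernel as derivative at 0. Local injectivity makes this parametrization constant,
so the inclusion vanishes. -/
theorem ker_eq_bot_of_injOn {E F : Type*} [NormedAddCommGroup E] [NormedSpace ℝ E]
    [CompleteSpace E] [NormedAddCommGroup F] [NormedSpace ℝ F] [FiniteDimensional ℝ F]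
    {f : E → F} {f' : E →L[ℝ] F} {a : E} {s : Set E} (hf : HasStrictFDerivAt f f' a)
    (hf' : f'.range = ⊤) (hs : s ∈ 𝓝 a) (hinj : Set.InjOn f s) : f'.ker = ⊥ := by
  have h1 := hf.to_implicitFunction hf'
  set φ := hf.implicitFunction f f' hf' (f a) with hφ
  have h0 : φ 0 = a := hf.implicitFunction_apply_image hf'
  have h2 : ∀ᶠ z in 𝓝 (0 : f'.ker), f (φ z) = f a :=
    ((continuous_const.prodMk continuous_id).tendsto' (0 : f'.ker) (f a, 0) rfl).eventually
      (hf.map_implicitFunction_eq hf')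
  have h3 : ∀ᶠ z in 𝓝 (0 : f'.ker), φ z ∈ s := by
    have := h1.hasFDerivAt.continuousAt
    exact this.eventually_mem (by rwa [h0])
  have h4 : φ =ᶠ[𝓝 0] fun _ => a := by
    filter_upwards [h2, h3] with z hz hz'
    exact hinj hz' (mem_of_mem_nhds hs) hz
  have h5 := h1.hasFDerivAt.unique ((hasFDerivAt_const a (0 : f'.ker)).congr_of_eventuallyEq h4)
  refine (Submodule.eq_bot_iff _).2 fun x hx => ?_
  exact DFunLike.congr_fun h5 ⟨x, hx⟩

/-- Equality of dimensions is not assumed: it follows from `ker_eq_bot_of_injOn` applied to the map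
read in charts. The inverse function theorem then does the rest. -/
theorem contMDiff_symm_of_surjective_mfderiv {E F : Type*} [NormedAddCommGroup E]
    [NormedSpace ℝ E] [FiniteDimensional ℝ E] [NormedAddCommGroup F] [NormedSpace ℝ F]
    [FiniteDimensional ℝ F] {M N : Type*} [TopologicalSpace M] [ChartedSpace E M]
    [TopologicalSpace N] [ChartedSpace F N] [IsManifold 𝓘(ℝ, E) ∞ M] [IsManifold 𝓘(ℝ, F) ∞ N]
    (f : M ≃ₜ N)
    (hf : ContMDiff 𝓘(ℝ, E) 𝓘(ℝ, F) ∞ f)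
    (hf' : ∀ x, Function.Surjective (mfderiv 𝓘(ℝ, E) 𝓘(ℝ, F) f x)) :
    ContMDiff 𝓘(ℝ, F) 𝓘(ℝ, E) ∞ f.symm := by
  have : CompleteSpace E := FiniteDimensional.complete ℝ E
  have : CompleteSpace F := FiniteDimensional.complete ℝ F
  intro y
  obtain ⟨x, rfl⟩ := f.surjective y
  let g : OpenPartialHomeomorph E F :=
    (chartAt E x).symm.trans (f.toOpenPartialHomeomorph.trans (chartAt F (f x)))
  have hx : chartAt E x x ∈ g.source := by simp [g]
  have hgx : g (chartAt E x x) = chartAt F (f x) (f x) := by simp [g]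
  have hd : MDifferentiableAt 𝓘(ℝ, E) 𝓘(ℝ, F) f x := (hf x).mdifferentiableAt (by simp)
  have h1 : ContDiffAt ℝ ∞ g (chartAt E x x) := by
    have := (contMDiffAt_iff.1 (hf x)).2
    simp only [mfld_simps, contDiffWithinAt_univ] at this
    exact this
  have h2 : HasFDerivAt g (mfderiv 𝓘(ℝ, E) 𝓘(ℝ, F) f x : E →L[ℝ] F) (chartAt E x x) := by
    have := hd.hasMFDerivAt.2
    simp only [mfld_simps] at this
    exact hasFDerivWithinAt_univ.1 this
  generalize hL : (mfderiv 𝓘(ℝ, E) 𝓘(ℝ, F) f x : E →L[ℝ] F) = L at h2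
  have hsurj : L.range = ⊤ := by
    rw [← hL]; exact LinearMap.range_eq_top.2 (hf' x)
  have h3 : HasStrictFDerivAt g L (chartAt E x x) := h1.hasStrictFDerivAt' h2 (by simp)
  have hker := ker_eq_bot_of_injOn h3 hsurj (g.open_source.mem_nhds hx) g.injOn
  let e : E ≃L[ℝ] F := ContinuousLinearEquiv.ofBijective L hker hsurj
  have hsymm : g.symm (chartAt F (f x) (f x)) = chartAt E x x := by
    rw [← hgx, g.left_inv hx]
  have h4 : ContDiffAt ℝ ∞ g.symm (chartAt F (f x) (f x)) := by
    refine g.contDiffAt_symm (f₀' := e) (by rw [← hgx]; exact g.map_source hx) ?_ ?_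
    · rw [hsymm]; exact h2
    · rw [hsymm]; exact h1
  refine contMDiffAt_iff.2 ⟨f.symm.continuous.continuousAt, ?_⟩
  simp only [mfld_simps, f.symm_apply_apply, contDiffWithinAt_univ]
  exact h4

end General

/-! ### The model of the tangent space at the centre as a quotient of `W` -/

section Coordinates
variable {n : ℕ} {W : Type*} [AddCommGroup W] [Module ℝ W]

theorem affineVec_single (b : Basis (Fin (n + 1)) ℝ W) (t : ℝ) (j : Fin n) :
    affineVec b (t • EuclideanSpace.single j (1 : ℝ)) = b 0 + t • b j.succ := by
  simp [affineVec]

theorem affineCoord_self (b : Basis (Fin (n + 1)) ℝ W) {A : ℙ ℝ W}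
    (h : Projectivization.mk ℝ (b 0) (b.ne_zero 0) = A) : affineCoord b A = 0 := by
  rw [← h, affineCoord_mk]
  ext i
  simp

variable [Fact (finrank ℝ W = n + 1)] (A : ℙ ℝ W)

variable (n) in
/-- The basis of `W` whose affine chart is the preferred chart at `A`. -/
def centreBasis : Basis (Fin (n + 1)) ℝ W := (exists_basis n A).choose

theorem mem_source_centreBasis : A ∈ (affineChart (centreBasis n A)).source :=
  (exists_basis n A).choose_spec

variable (n) in
/-- The representative of `A` normalized with respect to the preferred chart at `A`. -/
def centreVec : W := affineVec (centreBasis n A) (affineCoord (centreBasis n A) A)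

theorem centreVec_ne_zero : centreVec n A ≠ 0 := affineVec_ne_zero _ _

theorem mk_centreVec : Projectivization.mk ℝ (centreVec n A) (centreVec_ne_zero A) = A :=
  (affineChart (centreBasis n A)).left_inv (mem_source_centreBasis A)

theorem repr_centreVec_zero : (centreBasis n A).repr (centreVec n A) 0 = 1 :=
  repr_affineVec_zero _ _

theorem repr_centreVec_succ (k : Fin n) :
    (centreBasis n A).repr (centreVec n A) k.succ = affineCoord (centreBasis n A) A k :=
  repr_affineVec_succ _ _ _

variable (n) in
/-- The projection `W → W / A ≃ T_A ℙ W`, in terms of coordinates with respect to the preferred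
basis. -/
def coordToTan : (Fin (n + 1) → ℝ) →ₗ[ℝ] Tan n A where
  toFun x := (WithLp.toLp 2 fun k : Fin n => x k.succ - x 0 * affineCoord (centreBasis n A) A k :
    EuclideanSpace ℝ (Fin n))
  map_add' x y := by
    change (_ : EuclideanSpace ℝ (Fin n)) = (_ : EuclideanSpace ℝ (Fin n)) + _
    ext k
    simp
    ring
  map_smul' r x := by
    change (_ : EuclideanSpace ℝ (Fin n)) = r • (_ : EuclideanSpace ℝ (Fin n))
    ext k
    simp
    ring

variable (n) in
/-- The projection `W → W / A ≃ T_A ℙ W`. -/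
def toTan : W →ₗ[ℝ] Tan n A := coordToTan n A ∘ₗ (centreBasis n A).equivFun.toLinearMap

variable (n) in
/-- The section of `toTan` along the vectors of the preferred basis. -/
def ofTan : Tan n A →ₗ[ℝ] W where
  toFun x := ∑ k, (show EuclideanSpace ℝ (Fin n) from x) k • centreBasis n A k.succ
  map_add' x y := by
    rw [← Finset.sum_add_distrib]
    exact Finset.sum_congr rfl fun k _ => add_smul _ _ _
  map_smul' r x := by
    rw [Finset.smul_sum]
    exact Finset.sum_congr rfl fun k _ => mul_smul _ _ _

theorem repr_ofTan_zero (x : Tan n A) : (centreBasis n A).repr (ofTan n A x) 0 = 0 := by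
  simp [ofTan, Fin.succ_ne_zero]

theorem repr_ofTan_succ (x : Tan n A) (k : Fin n) :
    (centreBasis n A).repr (ofTan n A x) k.succ = (show EuclideanSpace ℝ (Fin n) from x) k := by
  simp [ofTan, Finsupp.single_apply]

theorem toTan_coord (v : W) (k : Fin n) :
    WithLp.ofLp (p := 2) (V := Fin n → ℝ) (toTan n A v) k =
      (centreBasis n A).repr v k.succ -
        (centreBasis n A).repr v 0 * affineCoord (centreBasis n A) A k :=
  rfl

theorem toTan_ofTan (x : Tan n A) : toTan n A (ofTan n A x) = x := by
  change (_ : EuclideanSpace ℝ (Fin n)) = _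
  ext k
  refine (toTan_coord ..).trans ?_
  simp [repr_ofTan_zero, repr_ofTan_succ]

theorem toTan_centreVec : toTan n A (centreVec n A) = 0 := by
  change (_ : EuclideanSpace ℝ (Fin n)) = 0
  ext k
  refine (toTan_coord ..).trans ?_
  simp [repr_centreVec_zero, repr_centreVec_succ]

/-- The splitting of $W$ into the line of $A$ and the span of the remaining preferred basis vectors;
`centreVec` has zeroth coordinate 1. -/
theorem smul_centreVec_add_ofTan_toTan (v : W) :
    (centreBasis n A).repr v 0 • centreVec n A + ofTan n A (toTan n A v) = v := by
  refine (centreBasis n A).ext_elem fun i => ?_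
  refine Fin.cases ?_ (fun k => ?_) i
  · simp [repr_centreVec_zero, repr_ofTan_zero]
  · simp [repr_centreVec_succ, repr_ofTan_succ, toTan_coord]

/-! ### Natural bases in coordinates -/

/-- The tangent space at $B$ is read in the preferred chart at $B$, so the differential is that of a
chart transition. Keeping $B$ as a variable allows it to be replaced by the centre. -/
theorem mfderiv_affineChart_symm (b : Basis (Fin (n + 1)) ℝ W) (X : EuclideanSpace ℝ (Fin n))
    (B : ℙ ℝ W) (h : (affineChart b).symm X = B) :
    (mfderiv (𝓡 n) (𝓡 n) (affineChart b).symm X :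
      EuclideanSpace ℝ (Fin n) →L[ℝ] EuclideanSpace ℝ (Fin n)) =
      fderiv ℝ (affineChart (centreBasis n B) ∘ (affineChart b).symm) X := by
  subst h
  have hd : (affineChart b).MDifferentiable (𝓡 n) (𝓡 n) :=
    mdifferentiable_of_mem_atlas (Set.mem_range_self b)
  rw [(hd.mdifferentiableAt_symm (x := X) trivial).mfderiv]
  simp only [mfld_simps, fderivWithin_univ]
  rfl

theorem naturalBasis_apply (b : Basis (Fin (n + 1)) ℝ W)
    (h0 : Projectivization.mk ℝ (b 0) (b.ne_zero 0) = A) (hb : A ∈ (affineChart b).source)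
    (j : Fin n) :
    (naturalBasis b hb : Fin n → Tan n A) j =
      ((centreBasis n A).repr (b 0) 0)⁻¹ • toTan n A (b j.succ) := by
  set c := centreBasis n A with hc
  have hX : affineChart b A = 0 := affineCoord_self b h0
  have hsymm : (affineChart b).symm 0 = A := by rw [← hX, (affineChart b).left_inv hb]
  have hc0 : c.repr (b 0) 0 ≠ 0 := by
    rw [← mem_affineChart_source_mk c _ (b.ne_zero 0), h0]
    exact mem_source_centreBasis A
  have hk : ∀ k : Fin n, c.repr (b 0) k.succ = c.repr (b 0) 0 * affineCoord c A k := by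
    intro k
    rw [← h0, affineCoord_mk]
    simp [mul_div_cancel₀ _ hc0]
  change (mfderiv (𝓡 n) (𝓡 n) (affineChart b).symm (affineChart b A)
      (EuclideanSpace.single j (1 : ℝ)) : EuclideanSpace ℝ (Fin n)) = _
  rw [hX]
  refine (DFunLike.congr_fun (mfderiv_affineChart_symm b 0 A hsymm) _).trans ?_
  rw [← hc]
  have hd : DifferentiableAt ℝ (affineChart c ∘ (affineChart b).symm) 0 := by
    refine ((contDiffOn_transition b c 1).contDiffAt ?_).differentiableAt one_ne_zero
    refine ((affineChart b).continuousOn_symm.isOpen_inter_preimage (affineChart b).open_target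
      (affineChart c).open_source |>.mem_nhds (x := 0) ⟨trivial, ?_⟩) |> Filter.mem_of_superset <|
      Set.inter_subset_right
    rw [Set.mem_preimage, hsymm]
    exact mem_source_centreBasis A
  have hline : HasDerivAt (fun t : ℝ => t • EuclideanSpace.single j (1 : ℝ))
      (EuclideanSpace.single j (1 : ℝ)) 0 := by
    simpa using (hasDerivAt_id (0 : ℝ)).smul_const (EuclideanSpace.single j (1 : ℝ))
  -- The directional derivative is computed twice, by the chain rule and, in `h3`, by the quotient
  -- rule along the line $b_0+tb_j$; uniqueness of derivatives equates the two.
  have h1 := HasFDerivAt.comp_hasDerivAt_of_eq (0 : ℝ) hd.hasFDerivAt hline (by simp)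
  change (_ : EuclideanSpace ℝ (Fin n)) = (_ : ℝ) • (_ : EuclideanSpace ℝ (Fin n))
  ext k
  have h2 := (EuclideanSpace.proj (𝕜 := ℝ) k).hasFDerivAt.comp_hasDerivAt (0 : ℝ) h1
  have h3 : HasDerivAt (fun t : ℝ => (c.repr (b 0) k.succ + t * c.repr (b j.succ) k.succ) /
      (c.repr (b 0) 0 + t * c.repr (b j.succ) 0))
      ((c.repr (b j.succ) k.succ * c.repr (b 0) 0 - c.repr (b 0) k.succ * c.repr (b j.succ) 0) /
        c.repr (b 0) 0 ^ 2) 0 := by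
    have hl : ∀ i, HasDerivAt (fun t : ℝ => c.repr (b 0) i + t * c.repr (b j.succ) i)
        (c.repr (b j.succ) i) 0 := fun i => by
      simpa using ((hasDerivAt_id (0 : ℝ)).mul_const (c.repr (b j.succ) i)).const_add
        (c.repr (b 0) i)
    have := (hl k.succ).div (hl 0) (by simpa using hc0)
    simp only [zero_mul, add_zero] at this
    exact this
  have h4 := h2.unique (h3.congr_of_eventuallyEq (.of_forall fun t => ?_))
  · refine h4.trans ?_
    -- As $b_0$ represents $A$, its coordinates are proportional to those of `centreVec`; one factor
    -- of the squared denominator cancels.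
    rw [hk]
    change _ = (c.repr (b 0) 0)⁻¹ *
      WithLp.ofLp (p := 2) (V := Fin n → ℝ) (toTan n A (b j.succ)) k
    rw [toTan_coord, ← hc]
    field_simp
  · change affineCoord c (.mk ℝ (affineVec b (t • EuclideanSpace.single j (1 : ℝ))) _) k = _
    rw [affineCoord_mk, affineVec_single]
    simp

/-! ### The natural basis in terms of homogeneous coordinates of the frame -/

variable (n) in
/-- The matrix with columns `A` and the first `n` of the `n + 1` given coordinate vectors. -/
def frameMatrix (x : Fin (n + 1) → Fin (n + 1) → ℝ) : Matrix (Fin (n + 1)) (Fin (n + 1)) ℝ :=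
  .of fun i j => (Fin.cons (centreBasis n A |>.repr (centreVec n A)) (fun j => x j.castSucc) :
    Fin (n + 1) → Fin (n + 1) → ℝ) j i

variable (n) in
/-- The homogeneous coordinates of the unit point, up to a common factor. -/
def unitCoord (x : Fin (n + 1) → Fin (n + 1) → ℝ) : Fin (n + 1) → ℝ :=
  (frameMatrix n A x).cramer (x (Fin.last n))

variable (n) in
/-- The natural basis of a frame in terms of coordinates of its points `A₁, …, Aₙ, E`. -/
def frameFormula (x : Fin (n + 1) → Fin (n + 1) → ℝ) (j : Fin n) : Tan n A :=
  (unitCoord n A x j.succ / unitCoord n A x 0) • coordToTan n A (x j.castSucc)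

theorem contDiff_unitCoord (k : WithTop ℕ∞) (i : Fin (n + 1)) :
    ContDiff ℝ k fun x => unitCoord n A x i := by
  refine contDiff_cramer (fun i j => ?_) (fun i => ?_) i
  · refine Fin.cases ?_ (fun j => ?_) j
    · simp only [frameMatrix, Matrix.of_apply, Fin.cons_zero]
      exact contDiff_const
    · simp only [frameMatrix, Matrix.of_apply, Fin.cons_succ]
      fun_prop
  · fun_prop

theorem contDiffAt_frameFormula (k : WithTop ℕ∞) {x : Fin (n + 1) → Fin (n + 1) → ℝ}
    (hx : unitCoord n A x 0 ≠ 0) : ContDiffAt ℝ k (frameFormula n A) x := by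
  refine contDiffAt_pi.2 fun j => ?_
  have h1 := (contDiff_unitCoord A k j.succ).contDiffAt.div (contDiff_unitCoord A k 0).contDiffAt hx
  have h2 := ((coordToTan n A).toContinuousLinearMap.contDiff.comp
    (contDiff_apply ℝ (Fin (n + 1) → ℝ) j.castSucc)).contDiffAt (x := x) (n := k)
  exact h1.smul h2

/-- Write $b_i=\mu_iu_i$ with $u=(a,v_0,\dots,v_{n-1})$. Since $\sum b_i$ is a multiple of $v_n$,
the vector $\mu$ is proportional to Cramer's solution, and only the ratios $\mu_j/\mu_0$ enter the
natural basis. The right-hand side is free of $b$ and involves only the chosen representatives. -/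
theorem Generates.frameFormula_eq {A : ℙ ℝ W} {b : Basis (Fin (n + 1)) ℝ W}
    {R : Fin (n + 1) → ℙ ℝ W} (hb : Generates b (Fin.cons A R : Fin (n + 2) → ℙ ℝ W))
    {v : Fin (n + 1) → W} (hv : ∀ i, v i ≠ 0) (hR : ∀ i, Projectivization.mk ℝ (v i) (hv i) = R i) :
    unitCoord n A (fun i => (centreBasis n A).repr (v i)) 0 ≠ 0 ∧
      (naturalBasis b hb.mem_source : Fin n → Tan n A) =
        frameFormula n A fun i => (centreBasis n A).repr (v i) := by
  set c := centreBasis n A with hc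
  let u : Fin (n + 1) → W := Fin.cons (centreVec n A) fun j => v j.castSucc
  have hu : ∀ i, ∃ μ : ℝ, μ • u i = b i := by
    intro i
    refine Fin.cases ?_ (fun j => ?_) i
    · have := (hb.1 0).trans (mk_centreVec (n := n) A).symm
      exact (Projectivization.mk_eq_mk_iff' ..).1 this
    · have := (hb.1 j.succ).trans (hR j.castSucc).symm
      exact (Projectivization.mk_eq_mk_iff' ..).1 this
  choose μ hμ using hu
  obtain ⟨hsum, hE⟩ := hb.2
  obtain ⟨s, hs⟩ := (Projectivization.mk_eq_mk_iff' ..).1 (hE.trans (hR (Fin.last n)).symm)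
  have hs0 : s ≠ 0 := by
    rintro rfl
    exact hsum (by rw [← hs, zero_smul])
  have hμ0 : ∀ i, μ i ≠ 0 := fun i h => b.ne_zero i (by rw [← hμ i, h, zero_smul])
  set x : Fin (n + 1) → Fin (n + 1) → ℝ := fun i => c.repr (v i) with hx
  have hM : frameMatrix n A x = c.toMatrix u := by
    ext i j
    refine Fin.cases ?_ (fun j => ?_) j <;> rfl
  -- The determinant of $b$ is $\prod\mu_i$ times that of $u$.
  have hdet : (frameMatrix n A x).det ≠ 0 := by
    have h1 := (c.isUnit_det b).ne_zero
    rw [show (b : Fin (n + 1) → W) = fun i => μ i • u i from funext fun i => (hμ i).symm] at h1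
    rw [AlternatingMap.map_smul_univ] at h1
    rw [hM, ← c.det_apply]
    exact right_ne_zero_of_mul h1
  have hmul : (frameMatrix n A x).mulVec μ = s • x (Fin.last n) := by
    ext i
    rw [hM]
    have := congrArg (fun w => c.repr w i) hs
    simp only [map_smul, ← hμ, map_sum, Finsupp.smul_apply, Finsupp.finsetSum_apply] at this
    simp only [Matrix.mulVec, dotProduct, Basis.toMatrix_apply, Pi.smul_apply, hx, this]
    exact Finset.sum_congr rfl fun j _ => mul_comm _ _
  -- Cramer's rule in the form $\operatorname{adj}(M)M\mu=\det(M)\mu$.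
  have hunit : s • unitCoord n A x = (frameMatrix n A x).det • μ := by
    rw [unitCoord, ← map_smul, ← hmul, Matrix.cramer_eq_adjugate_mulVec, Matrix.mulVec_mulVec,
      Matrix.adjugate_mul, Matrix.smul_mulVec, Matrix.one_mulVec]
  have hunit' : ∀ i, unitCoord n A x i = s⁻¹ * ((frameMatrix n A x).det * μ i) := fun i => by
    have := congrFun hunit i
    simp only [Pi.smul_apply, smul_eq_mul] at this
    rw [← this, inv_mul_cancel_left₀ hs0]
  refine ⟨?_, ?_⟩
  · rw [hunit']
    exact mul_ne_zero (inv_ne_zero hs0) (mul_ne_zero hdet (hμ0 0))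
  · funext j
    rw [naturalBasis_apply A b (hb.1 0), frameFormula, hunit', hunit', ← hμ, ← hμ]
    change _ = _ • toTan n A (v j.castSucc)
    rw [map_smul, map_smul, smul_smul]
    simp only [u, Fin.cons_zero, Fin.cons_succ, Finsupp.smul_apply, smul_eq_mul,
      repr_centreVec_zero]
    congr 1
    have := hμ0 0
    field_simp

theorem alpha_eq_naturalBasis {A : ℙ ℝ W} (R : AdaptedFrame n A) (b : Basis (Fin (n + 1)) ℝ W)
    (hb : Generates b (Fin.cons A R.1 : Fin (n + 2) → ℙ ℝ W)) :
    alpha R = naturalBasis b hb.mem_source := by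
  have hv : ∀ i, (R.1 i).rep ≠ 0 := fun i => Projectivization.rep_nonzero _
  have hR : ∀ i, Projectivization.mk ℝ (R.1 i).rep (hv i) = R.1 i := fun i => (R.1 i).mk_rep
  exact Subtype.ext ((R.2.exists_generates.choose_spec.frameFormula_eq hv hR).2.trans
    (hb.frameFormula_eq hv hR).2.symm)

theorem mem_maximalAtlas (b : Basis (Fin (n + 1)) ℝ W) (k : WithTop ℕ∞) :
    affineChart b ∈ IsManifold.maximalAtlas (𝓡 n) k (ℙ ℝ W) :=
  IsManifold.subset_maximalAtlas (Set.mem_range_self b)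

theorem contMDiff_alpha :
    ContMDiff (frameModel n) 𝓘(ℝ, Fin n → Tan n A) ∞
      (alpha : AdaptedFrame n A → LinearFrame n A) := by
  refine (ContMDiff.subtypeVal_comp_iff _ _).1 fun R₀ => ?_
  -- Charts frozen at $R_0$ give representatives depending smoothly on $R$ nearby, unlike `rep`.
  choose b hb using fun i => exists_basis n (R₀.1 i)
  let v : AdaptedFrame n A → Fin (n + 1) → W := fun R i => affineVec (b i) (affineCoord (b i) (R.1 i))
  have hv : ∀ R i, v R i ≠ 0 := fun R i => affineVec_ne_zero _ _
  let x : AdaptedFrame n A → Fin (n + 1) → Fin (n + 1) → ℝ := fun R i =>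
    (centreBasis n A).repr (v R i)
  have heval : ∀ i, ContMDiff (frameModel n) (𝓡 n) ∞ fun R : AdaptedFrame n A => R.1 i := fun i =>
    (contMDiff_eval i).comp contMDiff_subtype_val
  have hev : ∀ᶠ R in nhds R₀, (∀ i, R.1 i ∈ (affineChart (b i)).source) := by
    refine Filter.eventually_all.2 fun i => ?_
    exact (heval i).continuous.continuousAt.eventually_mem
      ((affineChart (b i)).open_source.mem_nhds (hb i))
  have hmk : ∀ R : AdaptedFrame n A, (∀ i, R.1 i ∈ (affineChart (b i)).source) →
      ∀ i, Projectivization.mk ℝ (v R i) (hv R i) = R.1 i := fun R hR i =>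
    (affineChart (b i)).left_inv (hR i)
  have hxs : ContMDiffAt (frameModel n) 𝓘(ℝ, Fin (n + 1) → Fin (n + 1) → ℝ) ∞ x R₀ := by
    refine contMDiffAt_pi_space.2 fun i => contMDiffAt_pi_space.2 fun k => ?_
    have h1 : ContMDiffAt (𝓡 n) (𝓡 n) ∞ (affineChart (b i)) (R₀.1 i) :=
      (contMDiffOn_of_mem_maximalAtlas (mem_maximalAtlas (b i) ∞)).contMDiffAt
        ((affineChart (b i)).open_source.mem_nhds (hb i))
    have h2 := h1.comp R₀ (heval i R₀)
    exact ((contDiff_affineVec (b i) (centreBasis n A) ∞ k).contMDiff _).comp R₀ h2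
  have hne := (R₀.2.exists_generates.choose_spec.frameFormula_eq (hv R₀) (hmk R₀ hb)).1
  have h3 := ((contDiffAt_frameFormula A ∞ hne).contMDiffAt (x := x R₀)).comp R₀ hxs
  refine h3.congr_of_eventuallyEq ?_
  filter_upwards [hev] with R hR
  exact (R.2.exists_generates.choose_spec.frameFormula_eq (hv R) (hmk R hR)).2

end Coordinates

section FramePoints
variable {n : ℕ} {W : Type*} [AddCommGroup W]

/-! ### Frames of given bases -/

variable (n) in
/-- The vectors `b₀, …, bₙ, ∑ bᵢ` representing the frame generated by `b`. -/
def framePoints (b : Fin (n + 1) → W) : Fin (n + 2) → W :=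
  Fin.snoc (α := fun _ => W) b (∑ i, b i)

theorem framePoints_castSucc (b : Fin (n + 1) → W) (i : Fin (n + 1)) :
    framePoints n b i.castSucc = b i := by
  simp [framePoints]

theorem framePoints_last (b : Fin (n + 1) → W) :
    framePoints n b (Fin.last (n + 1)) = ∑ i, b i := by
  simp [framePoints]

variable [Module ℝ W]

/-- All relations among $b_0,\dots,b_n,\sum b_i$ are multiples of $(1,\dots,1,-1)$. A relation
omitting one vector has a zero coefficient there, hence is trivial. -/
theorem linearIndependent_framePoints {b : Fin (n + 1) → W} (hb : LinearIndependent ℝ b)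
    (k : Fin (n + 2)) : LinearIndependent ℝ fun i => framePoints n b (k.succAbove i) := by
  rw [Fintype.linearIndependent_iff] at hb ⊢
  intro g hg
  let d : Fin (n + 2) → ℝ := k.insertNth (α := fun _ => ℝ) 0 g
  have hd : ∀ l, d (k.succAbove l) = g l := fun l => by simp [d]
  have hdk : d k = 0 := by simp [d]
  have h1 : ∑ m, d m • framePoints n b m = 0 := by
    rw [Fin.sum_univ_succAbove _ k, hdk]
    simpa [hd] using hg
  have h2 : ∑ i, (d (Fin.castSucc i) + d (Fin.last (n + 1))) • b i = 0 := by
    rw [Fin.sum_univ_castSucc, framePoints_last, Finset.smul_sum, ← Finset.sum_add_distrib] at h1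
    rw [← h1]
    exact Finset.sum_congr rfl fun i _ => by rw [framePoints_castSucc, add_smul]
  have h3 := hb _ h2
  have hlast : d (Fin.last (n + 1)) = 0 := by
    revert hdk
    refine Fin.lastCases ?_ (fun i => ?_) k
    · exact id
    · intro h
      simpa [h] using h3 i
  have hall : ∀ m, d m = 0 := by
    intro m
    refine Fin.lastCases hlast (fun i => ?_) m
    simpa [hlast] using h3 i
  exact fun l => (hd l).symm.trans (hall _)

theorem framePoints_ne_zero (b : Basis (Fin (n + 1)) ℝ W) (m : Fin (n + 2)) :
    framePoints n b m ≠ 0 := by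
  refine Fin.lastCases ?_ (fun i => ?_) m
  · obtain ⟨i, hi⟩ := Fin.exists_succAbove_eq (Fin.last_pos (n := n)).ne'
    rw [← hi]
    exact (linearIndependent_framePoints b.linearIndependent 0).ne_zero i
  · rw [framePoints_castSucc]
    exact b.ne_zero i

/-! ### Equivariance -/

theorem Generates.map {b : Basis (Fin (n + 1)) ℝ W} {R : Fin (n + 2) → ℙ ℝ W}
    (hb : Generates b R) (u : W ≃ₗ[ℝ] W) : Generates (b.map u) fun i => u • R i := by
  obtain ⟨h1, h0, h2⟩ := hb
  have hs : ∑ i, (b.map u) i = u (∑ i, b i) := by simp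
  refine ⟨fun i => ?_, by rw [hs]; exact u.map_ne_zero_iff.2 h0, ?_⟩
  · change _ = u • R i.castSucc
    rw [← h1, Projectivization.smul_mk]
    rfl
  · change _ = u • R (Fin.last (n + 1))
    rw [← h2, Projectivization.smul_mk]
    simp only [hs]
    rfl

end FramePoints

section Group
variable {n : ℕ} {W : Type*} [AddCommGroup W] [Module ℝ W] [Fact (finrank ℝ W = n + 1)]
  {A : ℙ ℝ W}

/-- The inverse chart of the transported basis is $g$ after the inverse chart of $b$; the chain rule
applies. -/
theorem naturalBasis_map (b : Basis (Fin (n + 1)) ℝ W) (hb : A ∈ (affineChart b).source)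
    (g : centreStab A) (u : W ≃ₗ[ℝ] W) (hu : ∀ M : ℙ ℝ W, g • M = u • M)
    (hb' : A ∈ (affineChart (b.map u)).source) :
    naturalBasis (b.map u) hb' = beta n A g • naturalBasis b hb := by
  have hX : affineChart (b.map u) A = affineChart b A := by
    have := (affineChart_map_smul b u A).1
    rwa [← hu, smul_centre] at this
  have hcomp : (affineChart (b.map u)).symm = (fun M : ℙ ℝ W => g • M) ∘ (affineChart b).symm := by
    funext X
    change Projectivization.mk ℝ _ _ = g • Projectivization.mk ℝ _ _
    rw [hu, Projectivization.smul_mk]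
    congr 1
    simp [affineVec, LinearEquiv.smul_def]
  have hd : (affineChart b).MDifferentiable (𝓡 n) (𝓡 n) :=
    mdifferentiable_of_mem_atlas (Set.mem_range_self b)
  refine Subtype.ext (funext fun j => ?_)
  change (mfderiv (𝓡 n) (𝓡 n) (affineChart (b.map u)).symm (affineChart (b.map u) A)
      (EuclideanSpace.single j (1 : ℝ)) : EuclideanSpace ℝ (Fin n)) =
    (mfderiv (𝓡 n) (𝓡 n) (fun M : ℙ ℝ W => g • M) A :
      EuclideanSpace ℝ (Fin n) →L[ℝ] EuclideanSpace ℝ (Fin n))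
      (mfderiv (𝓡 n) (𝓡 n) (affineChart b).symm (affineChart b A) (EuclideanSpace.single j (1 : ℝ)))
  rw [hX, hcomp]
  have h2 := mfderiv_comp (affineChart b A)
    (mdifferentiableAt_smul n A g ((affineChart b).symm (affineChart b A)))
    (hd.mdifferentiableAt_symm (x := affineChart b A) trivial)
  -- The chain rule takes the differential of $g$ at the image of the chart value, which equals $A$
  -- only propositionally.
  have h3 : ∀ B : ℙ ℝ W, B = A →
      (mfderiv (𝓡 n) (𝓡 n) (fun M : ℙ ℝ W => g • M) B :
        EuclideanSpace ℝ (Fin n) →L[ℝ] EuclideanSpace ℝ (Fin n)) =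
      mfderiv (𝓡 n) (𝓡 n) (fun M : ℙ ℝ W => g • M) A := by
    rintro _ rfl
    rfl
  exact (DFunLike.congr_fun h2 _).trans
    (DFunLike.congr_fun (h3 ((affineChart b).symm (affineChart b A)) ((affineChart b).left_inv hb)) _)

theorem alpha_smul (g : centreStab A) (R : AdaptedFrame n A) :
    alpha (g • R) = beta n A g • alpha R := by
  obtain ⟨u, hu⟩ := projGroup_apply_eq (g : projGroup W)
  obtain ⟨b, hb⟩ := R.2.exists_generates
  have hb' : Generates (b.map u) (Fin.cons A (g • R).1 : Fin (n + 2) → ℙ ℝ W) := by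
    convert! hb.map u using 1
    funext i
    refine Fin.cases ?_ (fun j => ?_) i
    · exact (smul_centre g).symm.trans (hu A)
    · exact hu (R.1 j)
  rw [alpha_eq_naturalBasis _ _ hb', alpha_eq_naturalBasis _ _ hb]
  exact naturalBasis_map b hb.mem_source g u hu _

/-! ### Transitivity on adapted frames and freeness on linear frames -/

theorem exists_smul_eq (R S : AdaptedFrame n A) : ∃ g : centreStab A, g • S = R := by
  obtain ⟨b, hb⟩ := R.2.exists_generates
  obtain ⟨b', hb'⟩ := S.2.exists_generates
  let u : W ≃ₗ[ℝ] W := b'.equiv b (Equiv.refl _)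
  have hu : b'.map u = b := Basis.eq_of_apply_eq fun i => by simp [u]
  have h1 := hb'.map u
  rw [hu] at h1
  have h2 : ∀ i, u • (Fin.cons A S.1 : Fin (n + 2) → ℙ ℝ W) i =
      (Fin.cons A R.1 : Fin (n + 2) → ℙ ℝ W) i := by
    intro i
    refine Fin.lastCases ?_ (fun j => ?_) i
    · obtain ⟨_, h⟩ := h1.2
      obtain ⟨_, h'⟩ := hb.2
      exact h.symm.trans h'
    · exact (h1.1 j).symm.trans (hb.1 j)
  let f : projGroup W := ⟨MulAction.toPermHom (W ≃ₗ[ℝ] W) (ℙ ℝ W) u, u, rfl⟩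
  refine ⟨⟨f, ?_⟩, Subtype.ext (funext fun j => ?_)⟩
  · exact h2 0
  · exact h2 j.succ

theorem linearFrame_smul_left_injective (ε : LinearFrame n A) :
    Function.Injective fun ψ : GLTan n A => ψ • ε := by
  intro ψ χ h
  refine Units.ext (ContinuousLinearMap.coe_injective ?_)
  refine LinearMap.ext_on_range ε.2.2 fun j => ?_
  exact congrFun (congrArg Subtype.val h) j

/-- Write $R=gS$. Equivariance shows that $\beta(g)$ fixes the basis $\alpha(S)$, so $g\in H$. -/
theorem toOrbit_eq_of_alpha_eq {R S : AdaptedFrame n A} (h : alpha R = alpha S) :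
    toOrbit R = toOrbit S := by
  obtain ⟨g, hg⟩ := exists_smul_eq R S
  refine toOrbit_eq_iff.2 ⟨⟨g, ?_⟩, hg⟩
  rw [MonoidHom.mem_ker]
  refine linearFrame_smul_left_injective (alpha S) ?_
  simp only [one_smul]
  rw [← alpha_smul, hg, h]

/-! ### Sections of `alpha` -/

/-- The adapted frame generated by a basis whose first vector represents the centre. -/
def frameOf (b : Basis (Fin (n + 1)) ℝ W)
    (h : Projectivization.mk ℝ (b 0) (b.ne_zero 0) = A) : AdaptedFrame n A :=
  ⟨fun i => .mk ℝ (framePoints n b i.succ) (framePoints_ne_zero b _), by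
    have : (Fin.cons A fun i : Fin (n + 1) =>
        Projectivization.mk ℝ (framePoints n b i.succ) (framePoints_ne_zero b _)) =
        fun m : Fin (n + 2) => Projectivization.mk ℝ (framePoints n b m) (framePoints_ne_zero b m) := by
      funext m
      refine Fin.cases ?_ (fun i => rfl) m
      exact h.symm
    change IsProjFrame (Fin.cons A _)
    rw [this]
    exact fun k => .mk _ _ (linearIndependent_framePoints b.linearIndependent k)⟩

theorem generates_frameOf (b : Basis (Fin (n + 1)) ℝ W)
    (h : Projectivization.mk ℝ (b 0) (b.ne_zero 0) = A) :
    Generates b (Fin.cons A (frameOf b h).1 : Fin (n + 2) → ℙ ℝ W) := by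
  refine ⟨fun i => ?_, ?_⟩
  · refine Fin.cases ?_ (fun j => ?_) i
    · exact h
    · rw [← Fin.succ_castSucc, Fin.cons_succ]
      simp only [frameOf, Fin.succ_castSucc, framePoints_castSucc]
  · have h0 : ∑ i, b i ≠ 0 := by
      rw [← framePoints_last]
      exact framePoints_ne_zero b _
    refine ⟨h0, ?_⟩
    rw [← Fin.succ_last, Fin.cons_succ]
    simp only [frameOf, Fin.succ_last, framePoints_last]

variable (n A) in
/-- The vectors `a, ε₁ + κ₁ a, …, εₙ + κₙ a`, where `a` represents the centre `A`. -/
def liftVec (κ : Fin n → ℝ) (ε : Fin n → Tan n A) : Fin (n + 1) → W :=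
  Fin.cons (centreVec n A) fun j => ofTan n A (ε j) + κ j • centreVec n A

theorem linearIndependent_liftVec (κ : Fin n → ℝ) (ε : LinearFrame n A) :
    LinearIndependent ℝ (liftVec n A κ ε) := by
  rw [Fintype.linearIndependent_iff]
  intro g hg
  rw [Fin.sum_univ_succ] at hg
  simp only [liftVec, Fin.cons_zero, Fin.cons_succ] at hg
  have h1 := congrArg (toTan n A) hg
  simp only [map_add, map_sum, map_smul, toTan_centreVec, toTan_ofTan, smul_zero, zero_add,
    add_zero, map_zero] at h1
  have h2 := Fintype.linearIndependent_iff.1 ε.2.1 (fun j => g j.succ) h1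
  simp only [h2, zero_smul, Finset.sum_const_zero, add_zero, smul_eq_zero, centreVec_ne_zero,
    or_false] at hg
  exact fun i => Fin.cases hg h2 i

variable (n A) in
/-- The basis of `W` formed by `liftVec`. -/
def liftBasis (κ : Fin n → ℝ) (ε : LinearFrame n A) : Basis (Fin (n + 1)) ℝ W :=
  basisOfLinearIndependentOfCardEqFinrank (linearIndependent_liftVec κ ε)
    (by simp [(Fact.out : finrank ℝ W = n + 1)])

theorem coe_liftBasis (κ : Fin n → ℝ) (ε : LinearFrame n A) :
    (liftBasis n A κ ε : Fin (n + 1) → W) = liftVec n A κ ε := by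
  simp [liftBasis]

theorem mk_liftBasis_zero (κ : Fin n → ℝ) (ε : LinearFrame n A) :
    Projectivization.mk ℝ (liftBasis n A κ ε 0) ((liftBasis n A κ ε).ne_zero 0) = A := by
  refine Eq.trans ?_ (mk_centreVec (n := n) A)
  simp only [coe_liftBasis]
  rfl

variable (n A) in
/-- A section of `alpha`. -/
def liftFrame (κ : Fin n → ℝ) (ε : LinearFrame n A) : AdaptedFrame n A :=
  frameOf (liftBasis n A κ ε) (mk_liftBasis_zero κ ε)

/-- `toTan` kills `centreVec`, so $\kappa$ is invisible to $\alpha$: it is a coordinate along the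
fibre. -/
theorem alpha_liftFrame (κ : Fin n → ℝ) (ε : LinearFrame n A) :
    alpha (liftFrame n A κ ε) = ε := by
  rw [alpha_eq_naturalBasis (liftFrame n A κ ε) _ (generates_frameOf _ (mk_liftBasis_zero κ ε))]
  refine Subtype.ext (funext fun j => ?_)
  rw [naturalBasis_apply A _ (mk_liftBasis_zero κ ε), coe_liftBasis]
  simp [liftVec, repr_centreVec_zero, toTan_centreVec, toTan_ofTan]

/-- A section passes through every frame, as needed for $p$ to be a submersion everywhere. Rescaling
a generating basis so that $b_0$ becomes `centreVec` leaves the frame unchanged, and $\kappa_j$ is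
the zeroth coordinate of the rescaled $b_j$. -/
theorem exists_liftFrame_eq (R : AdaptedFrame n A) :
    ∃ κ : Fin n → ℝ, liftFrame n A κ (alpha R) = R := by
  obtain ⟨b, hb⟩ := R.2.exists_generates
  obtain ⟨μ, hμ⟩ : ∃ μ : ℝ, μ • centreVec n A = b 0 :=
    (Projectivization.mk_eq_mk_iff' ..).1 ((hb.1 0).trans (mk_centreVec (n := n) A).symm)
  have hμ0 : μ ≠ 0 := by
    rintro rfl
    exact b.ne_zero 0 (by rw [← hμ, zero_smul])
  have hr : (centreBasis n A).repr (b 0) 0 = μ := by simp [← hμ, repr_centreVec_zero]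
  let κ : Fin n → ℝ := fun j => μ⁻¹ * (centreBasis n A).repr (b j.succ) 0
  have hv : ∀ i, μ • liftVec n A κ (alpha R) i = b i := by
    intro i
    refine Fin.cases hμ (fun j => ?_) i
    rw [alpha_eq_naturalBasis R b hb]
    simp only [liftVec, Fin.cons_succ, naturalBasis_apply A b (hb.1 0), hr, κ, map_smul]
    rw [smul_add, smul_smul, smul_smul, mul_inv_cancel₀ hμ0, one_smul, mul_inv_cancel_left₀ hμ0,
      add_comm]
    exact smul_centreVec_add_ofTan_toTan A (b j.succ)
  have hF : ∀ m, μ • framePoints n (liftVec n A κ (alpha R)) m = framePoints n b m := by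
    intro m
    refine Fin.lastCases ?_ (fun i => ?_) m
    · simp only [framePoints_last, Finset.smul_sum, hv]
    · simp only [framePoints_castSucc, hv]
  have hR : frameOf b (hb.1 0) = R := by
    have h1 := generates_frameOf b (hb.1 0)
    refine Subtype.ext (funext fun i => ?_)
    refine Fin.lastCases ?_ (fun j => ?_) i
    · obtain ⟨_, h⟩ := h1.2
      obtain ⟨_, h'⟩ := hb.2
      exact h.symm.trans h'
    · exact (h1.1 j.succ).symm.trans (hb.1 j.succ)
  refine ⟨κ, ?_⟩
  rw [← hR]
  refine Subtype.ext (funext fun i => ?_)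
  refine (Projectivization.mk_eq_mk_iff' ..).2 ⟨μ⁻¹, ?_⟩
  rw [inv_smul_eq_iff₀ hμ0, ← hF, coe_liftBasis, hR]

/-! ### Smoothness of the section -/

theorem contMDiff_mk {E : Type*} [NormedAddCommGroup E] [NormedSpace ℝ E] {H : Type*}
    [TopologicalSpace H] {I : ModelWithCorners ℝ E H} {M : Type*} [TopologicalSpace M]
    [ChartedSpace H M] {k : WithTop ℕ∞} {f : M → W} (hf : ∀ x, f x ≠ 0)
    (h : ∀ b : Basis (Fin (n + 1)) ℝ W, ∀ i, ContMDiff I 𝓘(ℝ, ℝ) k fun x => b.repr (f x) i) :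
    ContMDiff I (𝓡 n) k fun x => Projectivization.mk ℝ (f x) (hf x) := by
  intro x
  obtain ⟨b, hb⟩ := exists_basis n (Projectivization.mk ℝ (f x) (hf x))
  rw [mem_affineChart_source_mk] at hb
  have h1 : ContMDiffAt I 𝓘(ℝ, Fin n → ℝ) k
      (fun y => fun i : Fin n => b.repr (f y) i.succ / b.repr (f y) 0) x :=
    contMDiffAt_pi_space.2 fun i => (h b i.succ x).div₀ (h b 0 x) hb
  have h2 : ContMDiffAt I (𝓡 n) k
      (fun y => WithLp.toLp 2 fun i : Fin n => b.repr (f y) i.succ / b.repr (f y) 0) x :=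
    ((PiLp.contDiff_toLp (𝕜 := ℝ) (p := 2) (n := k) (E := fun _ : Fin n => ℝ)).contMDiff _).comp x h1
  have h3 : ContMDiff (𝓡 n) (𝓡 n) k (affineChart b).symm := by
    have := contMDiffOn_symm_of_mem_maximalAtlas (mem_maximalAtlas b k)
    exact contMDiffOn_univ.1 this
  refine ((h3 _).comp x h2).congr_of_eventuallyEq ?_
  have hne : ∀ᶠ y in nhds x, b.repr (f y) 0 ≠ 0 :=
    (h b 0).continuous.continuousAt.eventually_ne hb
  filter_upwards [hne] with y hy
  have := (affineChart b).left_inv ((mem_affineChart_source_mk b (f y) (hf y)).2 hy)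
  rw [← this]
  exact congrArg (affineChart b).symm (affineCoord_mk b (f y) (hf y))

theorem contDiff_repr_framePoints_liftVec (k : WithTop ℕ∞) (κ : Fin n → ℝ)
    (b : Basis (Fin (n + 1)) ℝ W) (m : Fin (n + 2)) (i : Fin (n + 1)) :
    ContDiff ℝ k fun ε : Fin n → Tan n A => b.repr (framePoints n (liftVec n A κ ε) m) i := by
  have h1 : ∀ l, ContDiff ℝ k fun ε : Fin n → Tan n A => b.repr (liftVec n A κ ε l) i := by
    refine Fin.cases (contDiff_const (c := b.repr (centreVec n A) i)) fun j => ?_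
    simp only [liftVec, Fin.cons_succ, map_add, Finsupp.add_apply]
    refine ContDiff.add ?_ contDiff_const
    exact (b.coord i ∘ₗ ofTan n A).toContinuousLinearMap.contDiff.comp
      (contDiff_apply ℝ (Tan n A) j)
  refine Fin.lastCases ?_ (fun l => ?_) m
  · simp only [framePoints_last, map_sum, Finsupp.finsetSum_apply]
    exact ContDiff.sum fun l _ => h1 l
  · simp only [framePoints_castSucc]
    exact h1 l

theorem contMDiff_liftFrame (κ : Fin n → ℝ) :
    ContMDiff 𝓘(ℝ, Fin n → Tan n A) (frameModel n) ∞ (liftFrame n A κ) := by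
  refine (ContMDiff.subtypeVal_comp_iff _ _).1 (contMDiff_pi_iff.2 fun j => ?_)
  refine contMDiff_mk (f := fun ε : LinearFrame n A =>
    framePoints n (liftBasis n A κ ε) j.succ) _ fun b i => ?_
  simp only [coe_liftBasis]
  exact (contDiff_repr_framePoints_liftVec ∞ κ b j.succ i).contMDiff.comp contMDiff_subtype_val

theorem contMDiff_linearFrame_smul :
    ContMDiff
      (𝓘(ℝ, Tan n A →L[ℝ] Tan n A).prod 𝓘(ℝ, Fin n → Tan n A)) 𝓘(ℝ, Fin n → Tan n A) ∞
      (fun q : GLTan n A × LinearFrame n A => q.1 • q.2) := by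
  refine (ContMDiff.subtypeVal_comp_iff _ _).1 (contMDiff_pi_space.2 fun j => ?_)
  have h1 : ContMDiff (𝓘(ℝ, Tan n A →L[ℝ] Tan n A).prod 𝓘(ℝ, Fin n → Tan n A))
      𝓘(ℝ, Tan n A →L[ℝ] Tan n A) ∞
      fun q : GLTan n A × LinearFrame n A => (q.1 : Tan n A →L[ℝ] Tan n A) :=
    Units.contMDiff_val.comp contMDiff_fst
  have h2 : ContMDiff (𝓘(ℝ, Tan n A →L[ℝ] Tan n A).prod 𝓘(ℝ, Fin n → Tan n A))
      𝓘(ℝ, Fin n → Tan n A) ∞ fun q : GLTan n A × LinearFrame n A => (q.2 : Fin n → Tan n A) :=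
    contMDiff_subtype_val.comp contMDiff_snd
  exact h1.clm_apply (contMDiff_pi_space.1 h2 j)

/-! ### The linearizing isomorphism and the induced map -/

/-- Transitivity gives $g$ carrying a lift of $\varepsilon$ to a lift of $\psi\varepsilon$; then
$\beta(g)\varepsilon=\psi\varepsilon$, and freeness gives $\beta(g)=\psi$. Any $\varepsilon$ would
do. -/
theorem beta_surjective : Function.Surjective (beta n A) := by
  intro ψ
  let ε : LinearFrame n A := alpha (liftFrame n A 0
    ⟨fun i => (EuclideanSpace.basisFun (Fin n) ℝ).toBasis i,
      (EuclideanSpace.basisFun (Fin n) ℝ).toBasis.linearIndependent,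
      (EuclideanSpace.basisFun (Fin n) ℝ).toBasis.span_eq⟩)
  obtain ⟨g, hg⟩ := exists_smul_eq (liftFrame n A 0 (ψ • ε)) (liftFrame n A 0 ε)
  refine ⟨g, linearFrame_smul_left_injective ε ?_⟩
  have := alpha_smul g (liftFrame n A 0 ε)
  rw [hg, alpha_liftFrame, alpha_liftFrame] at this
  exact this.symm

variable (n A) in
/-- The isomorphism `G / H ≃ GL(V)` induced by `β`. -/
def betaBar : (centreStab A ⧸ kernelH n A) ≃* GLTan n A :=
  QuotientGroup.quotientKerEquivOfSurjective (beta n A) beta_surjective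

theorem alpha_eq_of_toOrbit_eq {R S : AdaptedFrame n A} (h : toOrbit R = toOrbit S) :
    alpha R = alpha S := by
  obtain ⟨⟨g, hg⟩, rfl⟩ := toOrbit_eq_iff.1 h
  change alpha (g • S) = _
  rw [alpha_smul, MonoidHom.mem_ker.1 hg, one_smul]

variable (n A) in
/-- The map `[R] ↦ α(R)`. -/
def alphaBar : OrbitSpace n A → LinearFrame n A :=
  Quotient.lift (s := MulAction.orbitRel (kernelH n A) (AdaptedFrame n A)) alpha fun _ _ h =>
    alpha_eq_of_toOrbit_eq (Quotient.sound h)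

theorem alphaBar_toOrbit (R : AdaptedFrame n A) : alphaBar n A (toOrbit R) = alpha R := rfl

theorem toOrbit_surjective : Function.Surjective (toOrbit : AdaptedFrame n A → OrbitSpace n A) :=
  Quotient.mk_surjective

theorem alphaBar_smul (g : centreStab A ⧸ kernelH n A) (x : OrbitSpace n A) :
    alphaBar n A (g • x) = betaBar n A g • alphaBar n A x := by
  obtain ⟨g, rfl⟩ := QuotientGroup.mk_surjective g
  obtain ⟨R, rfl⟩ := toOrbit_surjective x
  exact alpha_smul g R

theorem toOrbit_liftFrame_alphaBar (κ : Fin n → ℝ) (x : OrbitSpace n A) :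
    toOrbit (liftFrame n A κ (alphaBar n A x)) = x := by
  obtain ⟨R, rfl⟩ := toOrbit_surjective x
  exact toOrbit_eq_of_alpha_eq (alpha_liftFrame κ (alpha R))

variable (n A) in
/-- The map `[R] ↦ α(R)` as a homeomorphism. -/
def alphaHomeo : OrbitSpace n A ≃ₜ LinearFrame n A where
  toFun := alphaBar n A
  invFun ε := toOrbit (liftFrame n A 0 ε)
  left_inv := toOrbit_liftFrame_alphaBar 0
  right_inv := alpha_liftFrame 0
  continuous_toFun := continuous_quot_lift _ (contMDiff_alpha A).continuous
  continuous_invFun := continuous_quot_mk.comp (contMDiff_liftFrame 0).continuous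

/-! ### Smooth structures on the orbit space -/

theorem contMDiff_alphaHomeo_symm {m : ℕ}
    [ChartedSpace (EuclideanSpace ℝ (Fin m)) (OrbitSpace n A)] (h : IsQuotientManifold n A m) :
    ContMDiff 𝓘(ℝ, Fin n → Tan n A) (𝓡 m) ∞ (alphaHomeo n A).symm :=
  h.contMDiff.comp (contMDiff_liftFrame 0)

/-- Since $p=\bar\alpha^{-1}\circ\alpha$, surjectivity of $dp$ passes to the outer factor
$d(\bar\alpha^{-1})$, so $\bar\alpha^{-1}$ is a bijective submersion. -/
theorem contMDiff_alphaHomeo {m : ℕ}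
    [ChartedSpace (EuclideanSpace ℝ (Fin m)) (OrbitSpace n A)] (h : IsQuotientManifold n A m) :
    ContMDiff (𝓡 m) 𝓘(ℝ, Fin n → Tan n A) ∞ (alphaHomeo n A) := by
  have := h.isManifold
  refine contMDiff_symm_of_surjective_mfderiv (alphaHomeo n A).symm
    (contMDiff_alphaHomeo_symm h) fun ε => ?_
  have h1 : (toOrbit : AdaptedFrame n A → OrbitSpace n A) = (alphaHomeo n A).symm ∘ alpha :=
    funext fun R => ((alphaHomeo n A).symm_apply_apply (toOrbit R)).symm
  have h2 := h.surjective_mfderiv (liftFrame n A 0 ε)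
  have hα : alpha (liftFrame n A 0 ε) = ε := alpha_liftFrame 0 ε
  rw [h1, mfderiv_comp _ ((contMDiff_alphaHomeo_symm h).mdifferentiable (by simp) _)
    ((contMDiff_alpha A).mdifferentiable (by simp) _)] at h2
  have h3 : Function.Surjective (mfderiv 𝓘(ℝ, Fin n → Tan n A) (𝓡 m) (alphaHomeo n A).symm
      (alpha (liftFrame n A 0 ε))) := fun v => (h2 v).imp' _ fun _ => id
  rwa [hα] at h3

/-- The structure is pulled back along $\bar\alpha$, an open embedding into $V^n\cong\mathbb{R}^m$,
with a single chart. -/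
theorem exists_isQuotientManifold :
    ∃ (m : ℕ) (_ : ChartedSpace (EuclideanSpace ℝ (Fin m)) (OrbitSpace n A)),
      IsQuotientManifold n A m := by
  let m := finrank ℝ (Fin n → Tan n A)
  let L : (Fin n → Tan n A) ≃L[ℝ] EuclideanSpace ℝ (Fin m) :=
    ContinuousLinearEquiv.ofFinrankEq (by simp [m])
  let e : OrbitSpace n A → EuclideanSpace ℝ (Fin m) := fun x => L (alphaHomeo n A x).1
  have he : Topology.IsOpenEmbedding e :=
    L.toHomeomorph.isOpenEmbedding.comp
      ((LinearFrame n A).2.isOpenEmbedding_subtypeVal.comp (alphaHomeo n A).isOpenEmbedding)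
  have : Nonempty (OrbitSpace n A) := ⟨(alphaHomeo n A).symm
    ⟨fun i => (EuclideanSpace.basisFun (Fin n) ℝ).toBasis i,
      (EuclideanSpace.basisFun (Fin n) ℝ).toBasis.linearIndependent,
      (EuclideanSpace.basisFun (Fin n) ℝ).toBasis.span_eq⟩⟩
  let _ := he.singletonChartedSpace
  have hp : ContMDiff (frameModel n) (𝓡 m) ∞ (toOrbit : AdaptedFrame n A → OrbitSpace n A) := by
    refine ContMDiff.of_comp_isOpenEmbedding he ?_
    exact L.contDiff.contMDiff.comp (contMDiff_subtype_val.comp (contMDiff_alpha A))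
  have ha : ContMDiff (𝓡 m) 𝓘(ℝ, Fin n → Tan n A) ∞ (alphaHomeo n A) := by
    refine (ContMDiff.subtypeVal_comp_iff _ _).1 ?_
    have h1 := L.symm.contDiff.contMDiff.comp (contMDiff_isOpenEmbedding he (I := 𝓡 m) (n := ∞))
    exact h1.congr fun x => (L.symm_apply_apply _).symm
  refine ⟨m, inferInstance, he.isManifold_singleton, hp, fun R => ?_⟩
  -- A smooth section of $p$ through $R$ differentiates to a right inverse of $dp$ at $R$.
  obtain ⟨κ, hκ⟩ := exists_liftFrame_eq R
  have hs := (contMDiff_liftFrame (A := A) κ).comp ha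
  have h1 : (toOrbit : AdaptedFrame n A → OrbitSpace n A) ∘ (liftFrame n A κ ∘ alphaHomeo n A) =
      id := funext (toOrbit_liftFrame_alphaBar κ)
  have h2 := mfderiv_comp (toOrbit R) (hp.mdifferentiable (by simp) _)
    (hs.mdifferentiable (by simp) (toOrbit R))
  rw [h1, mfderiv_id] at h2
  have h3 : (liftFrame n A κ ∘ alphaHomeo n A) (toOrbit R) = R := hκ
  rw [h3] at h2
  intro v
  exact ⟨_, (DFunLike.congr_fun h2 v).symm⟩

end Group

end

end ProjFrame

/-! ### Assembly of the theorem -/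

theorem theorem4p1 (n : ℕ) {W : Type*} [AddCommGroup W] [Module ℝ W]
    [Fact (Module.finrank ℝ W = n + 1)] (A : ℙ ℝ W) :
    -- the natural basis of `V` does not depend on the basis of `W` generating the frame
    (∀ (R : ProjFrame.AdaptedFrame n A) (b : Module.Basis (Fin (n + 1)) ℝ W)
      (hb : ProjFrame.Generates b (Fin.cons A R.1 : Fin (n + 2) → ℙ ℝ W)),
      ProjFrame.alpha R = ProjFrame.naturalBasis b hb.mem_source) ∧
    -- the identification of `G / H` with `GL(V)`
    ∃ e : (ProjFrame.centreStab A ⧸ ProjFrame.kernelH n A) ≃* ProjFrame.GLTan n A,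
      (∀ g : ProjFrame.centreStab A, e (QuotientGroup.mk g) = ProjFrame.beta n A g) ∧
    -- the induced map on the orbit space is well defined
    ∃ abar : ProjFrame.OrbitSpace n A → ProjFrame.LinearFrame n A,
      (∀ R : ProjFrame.AdaptedFrame n A, abar (ProjFrame.toOrbit R) = ProjFrame.alpha R) ∧
      -- equivariance
      (∀ (g : ProjFrame.centreStab A ⧸ ProjFrame.kernelH n A) (x : ProjFrame.OrbitSpace n A),
        abar (g • x) = e g • abar x) ∧
      -- `GL(V)` acts smoothly on the space of linear frames
      ContMDiff
        (𝓘(ℝ, ProjFrame.Tan n A →L[ℝ] ProjFrame.Tan n A).prod 𝓘(ℝ, Fin n → ProjFrame.Tan n A))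
        𝓘(ℝ, Fin n → ProjFrame.Tan n A) ∞
        (fun q : ProjFrame.GLTan n A × ProjFrame.LinearFrame n A => q.1 • q.2) ∧
      -- the orbit space is a quotient manifold, and for this smooth structure the action of `G / H`
      -- is smooth and the induced map is a diffeomorphism
      (∃ (m : ℕ) (_ : ChartedSpace (EuclideanSpace ℝ (Fin m)) (ProjFrame.OrbitSpace n A)),
        ProjFrame.IsQuotientManifold n A m) ∧
      ∀ (m : ℕ) [ChartedSpace (EuclideanSpace ℝ (Fin m)) (ProjFrame.OrbitSpace n A)],
        ProjFrame.IsQuotientManifold n A m →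
          ContMDiff (𝓘(ℝ, ProjFrame.Tan n A →L[ℝ] ProjFrame.Tan n A).prod (𝓡 m)) (𝓡 m) ∞
            (fun q : ProjFrame.GLTan n A × ProjFrame.OrbitSpace n A => e.symm q.1 • q.2) ∧
          ∃ D : ProjFrame.OrbitSpace n A ≃ₘ⟮𝓡 m, 𝓘(ℝ, Fin n → ProjFrame.Tan n A)⟯
              ProjFrame.LinearFrame n A, ⇑D = abar := by
  refine ⟨ProjFrame.alpha_eq_naturalBasis, ProjFrame.betaBar n A, fun _ => rfl,
    ProjFrame.alphaBar n A, ProjFrame.alphaBar_toOrbit, ProjFrame.alphaBar_smul,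
    ProjFrame.contMDiff_linearFrame_smul, ProjFrame.exists_isQuotientManifold, fun m _ h => ?_⟩
  have hs := ProjFrame.contMDiff_alphaHomeo_symm h
  have ha := ProjFrame.contMDiff_alphaHomeo h
  refine ⟨?_, ⟨(ProjFrame.alphaHomeo n A).toEquiv, ha, hs⟩, rfl⟩
  -- By equivariance the action on orbits is
  -- $(\psi,x)\mapsto\bar\alpha^{-1}(\psi\cdot\bar\alpha(x))$, a composite of smooth maps.
  have h1 := hs.comp (ProjFrame.contMDiff_linearFrame_smul.comp (contMDiff_id.prodMap ha))
  refine h1.congr fun q => ((ProjFrame.alphaHomeo n A).symm_apply_eq.2 ?_).symm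
  refine ((ProjFrame.alphaBar_smul _ _).trans ?_).symm
  rw [MulEquiv.apply_symm_apply]
  rfl
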